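/- Let $X$ be a (real or complex) Banach space, $1\le p<\infty$, and let $(A,D(A))$ be the generator of a strongly continuous semigroup $(S(t))_{t\ge 0}$ on $X$. Let $W^{1,p}([-1,0],X)$ be the Sobolev space of all $f\in L^p([-1,0],X)$ with weak derivative $f'\in L^p([-1,0],X)$, where $f(0)$ denotes the value at $0$ of the continuous representative of $f$, and let $\Phi:W^{1,p}([-1,0],X)\to X$ be a bounded linear operator. On $\mathcal E:=X\times L^p([-1,0],X)$ consider the operator $$\mathcal A:=\begin{pmatrix}A&\Phi\\0&\frac{d}{d\sigma}\end{pmatrix},\qquad D(\mathcal A):=\left\{\begin{pmatrix}x\\f\end{pmatrix}\in D(A)\times W^{1,p}([-1,0],X)\,:\,f(0)=x\right\}.$$ For $t\ge 0$, $x\in X$, $f\in L^p([-1,0],X)$ and $\tau\in[-1,0]$ let $$(S_t x)(\tau):=\begin{cases}S(t+\tau)x,&-t<\tau\le 0,\\0,&-1\le\tau\le -t,\end{cases}\qquad (T_0(t)f)(\tau):=\begin{cases}f(t+\tau),&t+\tau\le 0,\\0,&t+\tau>0.\end{cases}$$ Assume the following condition. (K) There is a function $q:(0,\infty)\to[0,\infty)$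 with $\lim_{t\to 0^+}q(t)=0$ such that $$\int_0^t\|\Phi(S_s x+T_0(s)f)\|\,ds\le q(t)\left\|\begin{pmatrix}x\\f\end{pmatrix}\right\|\qquad\text{for all }\begin{pmatrix}x\\f\end{pmatrix}\in D(\mathcal A)\text{ and all }t>0.$$ Suppose that $(S(t))_{t\ge 0}$ is immediately norm continuous, i.e. $t\mapsto S(t)$ is continuous from $(0,\infty)$ to $\mathcal L(X)$ with the operator norm. Then $(\mathcal A,D(\mathcal A))$ generates a strongly continuous semigroup $(\mathcal T(t))_{t\ge 0}$ on $\mathcal E$, and this semigroup is norm continuous for $t\ge 1$, i.e. $t\mapsto\mathcal T(t)$ is continuous from $[1,\infty)$ to $\mathcal L(\mathcal E)$ with the operator norm. -/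

import Mathlib

open Set Filter Topology MeasureTheory
open scoped ENNReal NNReal

noncomputable section

namespace DelayEquation

section Semigroups

variable {𝕜 : Type*} [RCLike 𝕜] {Y : Type*} [NormedAddCommGroup Y] [NormedSpace 𝕜 Y]

/-- `(T t)_{t ≥ 0}` is a strongly continuous semigroup of bounded linear operators on `Y`.
The values `T t` with `t < 0` are irrelevant. -/
structure IsC0Semigroup (T : ℝ → Y →L[𝕜] Y) : Prop where
  map_zero : T 0 = ContinuousLinearMap.id 𝕜 Y
  map_add : ∀ s t : ℝ, 0 ≤ s → 0 ≤ t → T (s + t) = (T s).comp (T t)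
  continuousOn_orbit : ∀ y : Y, ContinuousOn (fun t => T t y) (Ici 0)

/-- The unbounded operator `G`, with its domain, is the generator of `T`: `y ∈ D(G)` and `G y = z`
if and only if `(T h y - y) / h → z` as `h → 0+`. -/
def IsGenerator [NormedSpace ℝ Y] (T : ℝ → Y →L[𝕜] Y) (G : Y →ₗ.[𝕜] Y) : Prop :=
  ∀ y z : Y, (y, z) ∈ G.graph ↔
    Tendsto (fun h : ℝ => h⁻¹ • (T h y - y)) (𝓝[>] 0) (𝓝 z)

/-- The semigroup `T` is immediately norm continuous: `t ↦ T t` is continuous from `(0, ∞)` to the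
bounded operators with the operator norm. -/
def ImmediatelyNormContinuous (T : ℝ → Y →L[𝕜] Y) : Prop :=
  ContinuousOn T (Ioi 0)

end Semigroups

/-- Lebesgue measure on `[-1, 0]`. -/
abbrev delayMeasure : Measure ℝ := volume.restrict (Icc (-1 : ℝ) 0)

/-- The space `L^p([-1, 0], X)`. -/
abbrev Lp₀ (X : Type*) [NormedAddCommGroup X] (p : ℝ≥0∞) : Type _ :=
  Lp X p delayMeasure

section Sobolev

variable {X : Type*} [NormedAddCommGroup X] [NormedSpace ℝ X] {p : ℝ≥0∞}

/-- `f ∈ L^p([-1, 0], X)` is (almost everywhere equal to) the absolutely continuous function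
`σ ↦ x + ∫ r in 0..σ, g r`. In other words: `f` has the weak derivative `g`, and its continuous
representative takes the value `x` at `0`. -/
def IsPrimitive (f g : Lp₀ X p) (x : X) : Prop :=
  ∀ᵐ σ ∂delayMeasure, f σ = x + ∫ r in (0 : ℝ)..σ, g r

lemma intervalIntegrable_coe {X : Type*} [NormedAddCommGroup X] {p : ℝ≥0∞} [Fact (1 ≤ p)]
    (g : Lp₀ X p) {σ : ℝ} (hσ : σ ∈ Icc (-1 : ℝ) 0) :
    IntervalIntegrable g volume 0 σ := by
  have h : IntegrableOn g (Icc (-1 : ℝ) 0) volume :=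
    (Lp.memLp g).integrable (Fact.out : 1 ≤ p)
  refine (intervalIntegrable_iff.2 (h.mono_set ?_))
  rw [uIoc_of_ge hσ.2]
  exact fun r hr => ⟨hσ.1.trans hr.1.le, hr.2⟩

lemma ae_mem_Icc : ∀ᵐ σ ∂delayMeasure, σ ∈ Icc (-1 : ℝ) 0 :=
  ae_restrict_mem measurableSet_Icc

/-- The integral from `0` to `σ ∈ [-1, 0]` only depends on the class of the integrand. -/
lemma integral_congr_delay {u v : ℝ → X} (h : u =ᵐ[delayMeasure] v) {σ : ℝ}
    (hσ : σ ∈ Icc (-1 : ℝ) 0) : ∫ r in (0 : ℝ)..σ, u r = ∫ r in (0 : ℝ)..σ, v r := by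
  apply intervalIntegral.integral_congr_ae
  have h' := (ae_restrict_iff' measurableSet_Icc).1 h
  filter_upwards [h'] with r hr hmem
  rw [uIoc_of_ge hσ.2] at hmem
  exact hr ⟨hσ.1.trans hmem.1.le, hmem.2⟩

lemma IsPrimitive.add [Fact (1 ≤ p)] {f g f' g' : Lp₀ X p} {x x' : X}
    (h : IsPrimitive f g x) (h' : IsPrimitive f' g' x') :
    IsPrimitive (f + f') (g + g') (x + x') := by
  unfold IsPrimitive
  filter_upwards [h, h', Lp.coeFn_add f f', ae_mem_Icc] with σ h1 h2 h3 hσ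
  rw [h3, integral_congr_delay (Lp.coeFn_add g g') hσ]
  simp only [Pi.add_apply]
  rw [intervalIntegral.integral_add (intervalIntegrable_coe g hσ) (intervalIntegrable_coe g' hσ),
    h1, h2]
  abel

lemma IsPrimitive.zero : IsPrimitive (0 : Lp₀ X p) 0 0 := by
  unfold IsPrimitive
  filter_upwards [Lp.coeFn_zero X p delayMeasure, ae_mem_Icc] with σ h1 hσ
  rw [h1, integral_congr_delay (Lp.coeFn_zero X p delayMeasure) hσ]
  simp

lemma IsPrimitive.smul {𝕜 : Type*} [RCLike 𝕜] [NormedSpace 𝕜 X] [IsScalarTower ℝ 𝕜 X]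
    {f g : Lp₀ X p} {x : X} (c : 𝕜) (h : IsPrimitive f g x) :
    IsPrimitive (c • f) (c • g) (c • x) := by
  unfold IsPrimitive
  filter_upwards [h, Lp.coeFn_smul c f, ae_mem_Icc] with σ h1 h2 hσ
  rw [h2, integral_congr_delay (Lp.coeFn_smul c g) hσ]
  simp only [Pi.smul_apply]
  rw [intervalIntegral.integral_smul, h1, smul_add]

/-- The value at `0` and the weak derivative of `f` are unique. -/
lemma IsPrimitive.unique [CompleteSpace X] [Fact (1 ≤ p)] {f g g' : Lp₀ X p} {x x' : X}
    (h : IsPrimitive f g x) (h' : IsPrimitive f g' x') : x = x' ∧ g = g' := by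
  have hint : ∀ u : Lp₀ X p, IntegrableOn u (uIcc (0 : ℝ) (-1)) volume := fun u => by
    rw [uIcc_of_ge (by norm_num)]
    exact (Lp.memLp u).integrable (Fact.out : 1 ≤ p)
  have hcont : ∀ (u : Lp₀ X p) (y : X),
      ContinuousOn (fun σ => y + ∫ r in (0 : ℝ)..σ, u r) (Icc (-1 : ℝ) 0) := fun u y => by
    have := intervalIntegral.continuousOn_primitive_interval (hint u)
    rw [uIcc_of_ge (by norm_num)] at this
    exact continuousOn_const.add this
  have heq : EqOn (fun σ => x + ∫ r in (0 : ℝ)..σ, g r) (fun σ => x' + ∫ r in (0 : ℝ)..σ, g' r)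
      (Icc (-1 : ℝ) 0) := by
    refine Measure.eqOn_Icc_of_ae_eq volume (by norm_num) ?_ (hcont g x) (hcont g' x')
    filter_upwards [h, h'] with σ h1 h2
    exact h1.symm.trans h2
  have hx : x = x' := by simpa using heq (right_mem_Icc.2 (by norm_num : (-1 : ℝ) ≤ 0))
  refine ⟨hx, ?_⟩
  apply Lp.ext
  have hg : ∀ u : Lp₀ X p, IntervalIntegrable u volume 0 (-1) := fun u =>
    intervalIntegrable_coe u ⟨le_rfl, by norm_num⟩
  have hne : ∀ᵐ σ : ℝ, σ ≠ -1 ∧ σ ≠ 0 := by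
    filter_upwards [Measure.ae_ne volume (-1 : ℝ), Measure.ae_ne volume (0 : ℝ)] with σ a b
    exact ⟨a, b⟩
  refine (ae_restrict_iff' measurableSet_Icc).2 ?_
  filter_upwards [(hg g).ae_hasDerivAt_integral, (hg g').ae_hasDerivAt_integral, hne]
    with σ h1 h2 h3 hσ
  have hσ' : σ ∈ uIcc (0 : ℝ) (-1) := by rwa [uIcc_of_ge (by norm_num)]
  have d1 := h1 hσ' 0 left_mem_uIcc
  have d2 := h2 hσ' 0 left_mem_uIcc
  refine (d1.congr_of_eventuallyEq ?_).unique d2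
  filter_upwards [Ioo_mem_nhds (lt_of_le_of_ne hσ.1 h3.1.symm) (lt_of_le_of_ne hσ.2 h3.2)]
    with τ hτ
  have := heq (Ioo_subset_Icc_self hτ)
  simp only [hx] at this
  exact (add_left_cancel this).symm

/-- The Sobolev space `W^{1,p}([-1, 0], X)`, realised as the space of pairs `(f, f')` of a function
`f ∈ L^p` and its weak derivative `f' ∈ L^p`. The norm is `max ‖f‖_p ‖f'‖_p`, which is equivalent
to the usual one. -/
def W1p (𝕜 : Type*) [RCLike 𝕜] (X : Type*) [NormedAddCommGroup X] [NormedSpace ℝ X]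
    [NormedSpace 𝕜 X] [IsScalarTower ℝ 𝕜 X] (p : ℝ≥0∞) [Fact (1 ≤ p)] :
    Submodule 𝕜 (Lp₀ X p × Lp₀ X p) where
  carrier := {w | ∃ x, IsPrimitive w.1 w.2 x}
  add_mem' := fun ⟨x, hx⟩ ⟨y, hy⟩ => ⟨x + y, hx.add hy⟩
  zero_mem' := ⟨0, IsPrimitive.zero⟩
  smul_mem' := fun c _ ⟨x, hx⟩ => ⟨c • x, hx.smul c⟩

end Sobolev

section Operators

variable {𝕜 : Type*} [RCLike 𝕜] {X : Type*} [NormedAddCommGroup X] [NormedSpace ℝ X]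
  [NormedSpace 𝕜 X] [IsScalarTower ℝ 𝕜 X] {p : ℝ≥0∞} [Fact (1 ≤ p)]

variable (p) in
/-- The domain `{(x, f) ∈ D(A) × W^{1,p}([-1, 0], X) : f(0) = x}` in `X × L^p([-1, 0], X)`. -/
def delayDomain (A : X →ₗ.[𝕜] X) : Submodule 𝕜 (X × Lp₀ X p) where
  carrier := {z | z.1 ∈ A.domain ∧ ∃ g, IsPrimitive z.2 g z.1}
  add_mem' := fun ⟨hx, g, hg⟩ ⟨hy, g', hg'⟩ => ⟨A.domain.add_mem hx hy, g + g', hg.add hg'⟩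
  zero_mem' := ⟨A.domain.zero_mem, 0, IsPrimitive.zero⟩
  smul_mem' := fun c _ ⟨hx, g, hg⟩ => ⟨A.domain.smul_mem c hx, c • g, hg.smul c⟩

/-- The weak derivative `f'` of the second component of `(x, f)` in the domain. -/
def weakDeriv {A : X →ₗ.[𝕜] X} (z : delayDomain p A) : Lp₀ X p :=
  z.2.2.choose

lemma weakDeriv_spec {A : X →ₗ.[𝕜] X} (z : delayDomain p A) :
    IsPrimitive z.1.2 (weakDeriv z) z.1.1 :=
  z.2.2.choose_spec

/-- The operator matrix `(x, f) ↦ (A x + Φ f, f')` on `X × L^p([-1, 0], X)`, with domain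
`{(x, f) ∈ D(A) × W^{1,p}([-1, 0], X) : f(0) = x}`. -/
def delayOperator [CompleteSpace X] (A : X →ₗ.[𝕜] X) (Φ : W1p 𝕜 X p →L[𝕜] X) :
    (X × Lp₀ X p) →ₗ.[𝕜] (X × Lp₀ X p) where
  domain := delayDomain p A
  toFun :=
    { toFun := fun z =>
        (A ⟨z.1.1, z.2.1⟩ + Φ ⟨(z.1.2, weakDeriv z), z.1.1, weakDeriv_spec z⟩, weakDeriv z)
      map_add' := fun z w => by
        have hd : weakDeriv (z + w) = weakDeriv z + weakDeriv w :=
          ((weakDeriv_spec (z + w)).unique ((weakDeriv_spec z).add (weakDeriv_spec w))).2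
        have hA : A ⟨(z + w).1.1, (z + w).2.1⟩ = A ⟨z.1.1, z.2.1⟩ + A ⟨w.1.1, w.2.1⟩ :=
          A.map_add ⟨z.1.1, z.2.1⟩ ⟨w.1.1, w.2.1⟩
        have hΦ : (⟨((z + w).1.2, weakDeriv (z + w)), (z + w).1.1, weakDeriv_spec (z + w)⟩ :
              W1p 𝕜 X p)
            = ⟨(z.1.2, weakDeriv z), z.1.1, weakDeriv_spec z⟩
              + ⟨(w.1.2, weakDeriv w), w.1.1, weakDeriv_spec w⟩ :=
          Subtype.ext (Prod.ext rfl hd)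
        refine Prod.ext ?_ hd
        change A _ + Φ _ = (A _ + Φ _) + (A _ + Φ _)
        rw [hA, hΦ, map_add]
        abel
      map_smul' := fun c z => by
        have hd : weakDeriv (c • z) = c • weakDeriv z :=
          ((weakDeriv_spec (c • z)).unique ((weakDeriv_spec z).smul c)).2
        have hA : A ⟨(c • z).1.1, (c • z).2.1⟩ = c • A ⟨z.1.1, z.2.1⟩ :=
          A.map_smul c ⟨z.1.1, z.2.1⟩
        have hΦ : (⟨((c • z).1.2, weakDeriv (c • z)), (c • z).1.1, weakDeriv_spec (c • z)⟩ :
              W1p 𝕜 X p)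
            = c • ⟨(z.1.2, weakDeriv z), z.1.1, weakDeriv_spec z⟩ :=
          Subtype.ext (Prod.ext rfl hd)
        refine Prod.ext ?_ hd
        change A _ + Φ _ = c • (A _ + Φ _)
        rw [hA, hΦ, map_smul, smul_add] }

/-- The nilpotent left shift `T₀(t)`: `(T₀(t) f)(τ) = f(t + τ)` if `t + τ ≤ 0`, and `0` otherwise. -/
def leftShift (t : ℝ) (f : ℝ → X) (τ : ℝ) : X :=
  if t + τ ≤ 0 then f (t + τ) else 0

/-- The operator `S_t`: `(S_t x)(τ) = S(t + τ) x` if `-t < τ`, and `0` otherwise. -/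
def orbitSegment (S : ℝ → X →L[𝕜] X) (t : ℝ) (x : X) (τ : ℝ) : X :=
  if -t < τ then S (t + τ) x else 0

/-- The element `w` of `W^{1,p}([-1, 0], X)` is the function `S_t x + T₀(t) f`. -/
def IsSegment (S : ℝ → X →L[𝕜] X) (x : X) (f : Lp₀ X p) (t : ℝ) (w : W1p 𝕜 X p) : Prop :=
  ∀ᵐ τ ∂delayMeasure, w.1.1 τ = orbitSegment S t x τ + leftShift t f τ

/-- For `(x, f) ∈ D(A) × W^{1,p}` with `f(0) = x` and `t > 0`, the function `S_t x + T₀(t) f`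
belongs to `W^{1,p}([-1, 0], X)`. -/
lemma exists_isSegment [CompleteSpace X] {S : ℝ → X →L[𝕜] X} {A : X →ₗ.[𝕜] X}
    (hS : IsC0Semigroup S) (hA : IsGenerator S A) {z : X × Lp₀ X p} (hz : z ∈ delayDomain p A)
    {t : ℝ} (ht : 0 < t) : ∃ w : W1p 𝕜 X p, IsSegment S z.1 z.2 t w := by
  obtain ⟨hx, g, hg⟩ := hz
  obtain ⟨x, f⟩ := z
  simp only at hx hg ⊢
  have mp : MeasurePreserving (fun τ : ℝ => t + τ) volume volume := measurePreserving_add_left _ t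
  -- every function of the form `S_t y + T₀(t) u` is in `L^p`
  have hLp : ∀ (y : X) (u : Lp₀ X p),
      MemLp (fun τ => orbitSegment S t y τ + leftShift t u τ) p delayMeasure := by
    intro y u
    apply MemLp.add
    · have hind : orbitSegment S t y = (Ioi (-t)).indicator (fun τ => S (t + τ) y) := by
        ext τ; simp [orbitSegment, indicator]
      have hc : ContinuousOn (fun τ => S (t + τ) y) (Icc (-t) 0) :=
        (hS.continuousOn_orbit y).comp (by fun_prop) fun τ hτ => by
          simp only [mem_Ici]; linarith [hτ.1]
      obtain ⟨C, hC⟩ := isCompact_Icc.exists_bound_of_continuousOn hc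
      have hsm : AEStronglyMeasurable (orbitSegment S t y) delayMeasure := by
        rw [hind, aestronglyMeasurable_indicator_iff measurableSet_Ioi,
          Measure.restrict_restrict measurableSet_Ioi]
        refine (hc.aestronglyMeasurable measurableSet_Icc).mono_set ?_
        exact fun τ hτ => ⟨le_of_lt hτ.1, hτ.2.2⟩
      refine MemLp.of_bound hsm (max C 0) ?_
      filter_upwards [ae_mem_Icc] with τ hτ
      unfold orbitSegment
      split_ifs with h
      · exact (hC τ ⟨h.le, hτ.2⟩).trans (le_max_left _ _)
      · simp
    · have hind : leftShift t u =
          (Iic (-t)).indicator (fun τ => u (t + τ)) := by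
        ext τ
        simp only [leftShift, indicator, mem_Iic]
        congr 1
        exact propext ⟨fun h => by linarith, fun h => by linarith⟩
      rw [hind, memLp_indicator_iff_restrict measurableSet_Iic,
        Measure.restrict_restrict measurableSet_Iic]
      have h1 : MemLp (fun τ => u (t + τ)) p
          (volume.restrict ((fun τ : ℝ => t + τ) ⁻¹' Icc (-1 : ℝ) 0)) :=
        (Lp.memLp u).comp_measurePreserving
          (mp.restrict_preimage measurableSet_Icc)
      refine h1.mono_measure (Measure.restrict_mono ?_ le_rfl)
      intro τ hτ
      have := hτ.1; have := hτ.2.1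
      simp only [mem_Iic] at *
      exact ⟨by linarith, by linarith⟩
  -- the fundamental theorem of calculus for orbits in the domain of the generator
  set y : X := A ⟨x, hx⟩ with hy
  have hgen : Tendsto (fun h : ℝ => h⁻¹ • (S h x - x)) (𝓝[>] 0) (𝓝 y) :=
    (hA x y).1 (A.mem_graph ⟨x, hx⟩)
  have hder : ∀ r, 0 ≤ r → HasDerivWithinAt (fun s => S s x) (S r y) (Ioi r) r := by
    intro r hr
    rw [hasDerivWithinAt_iff_tendsto_slope' (by simp)]
    have h1 := ((S r).continuous.tendsto y).comp hgen
    have h2 : Tendsto (fun s : ℝ => s - r) (𝓝[>] r) (𝓝[>] 0) := by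
      refine tendsto_nhdsWithin_iff.2 ⟨?_, ?_⟩
      · have : Tendsto (fun s : ℝ => s - r) (𝓝 r) (𝓝 (r - r)) :=
          (continuous_id.sub continuous_const).tendsto r
        rw [sub_self] at this
        exact this.mono_left nhdsWithin_le_nhds
      · filter_upwards [self_mem_nhdsWithin] with s hs
        simpa using hs
    refine (h1.comp h2).congr' ?_
    filter_upwards [self_mem_nhdsWithin] with s hs
    have hs' : (0 : ℝ) ≤ s - r := by simpa using le_of_lt hs
    have hadd : S s x = S r (S (s - r) x) := by
      have := hS.map_add r (s - r) hr hs'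
      rw [add_sub_cancel] at this
      rw [this]; rfl
    have hsm : ∀ (c : ℝ) (v : X), S r (c • v) = c • S r v := fun c v =>
      map_real_smul (S r) (S r).continuous c v
    simp only [Function.comp, slope, vsub_eq_sub, hsm, map_sub, hadd]
  have hftc : ∀ r, 0 ≤ r → S r x = x + ∫ s in (0 : ℝ)..r, S s y := by
    intro r hr
    have hci : ∀ v : X, ContinuousOn (fun s => S s v) (uIcc 0 r) := fun v =>
      (hS.continuousOn_orbit v).mono fun s hs => by
        rw [uIcc_of_le hr] at hs; exact hs.1
    rw [intervalIntegral.integral_eq_sub_of_hasDeriv_right (hci x)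
      (fun s hs => hder s (by rw [min_eq_left hr] at hs; exact hs.1.le))
      ((hci y).intervalIntegrable), hS.map_zero]
    simp
  refine ⟨⟨((hLp x f).toLp _, (hLp y g).toLp _), S t x, ?_⟩, (hLp x f).coeFn_toLp⟩
  unfold IsPrimitive
  simp only
  -- transfer the identity for `f` to the shifted point
  have hg' : ∀ᵐ τ : ℝ, t + τ ∈ Icc (-1 : ℝ) 0 → f (t + τ) = x + ∫ r in (0 : ℝ)..(t + τ), g r :=
    mp.quasiMeasurePreserving.ae ((ae_restrict_iff' measurableSet_Icc).1 hg)
  filter_upwards [(hLp x f).coeFn_toLp, ae_mem_Icc, ae_restrict_of_ae hg'] with τ h1 hτ h2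
  rw [h1, integral_congr_delay (hLp y g).coeFn_toLp hτ]
  -- the orbit part of the integral
  have horb : ∀ σ, -t ≤ σ → σ ≤ 0 →
      ∫ s in (0 : ℝ)..σ, (orbitSegment S t y s + leftShift t g s) = S (t + σ) x - S t x := by
    intro σ h3 h4
    have e1 : ∫ s in (0 : ℝ)..σ, (orbitSegment S t y s + leftShift t g s)
        = ∫ s in (0 : ℝ)..σ, S (t + s) y := by
      apply intervalIntegral.integral_congr_ae
      filter_upwards with s hs
      rw [uIoc_of_ge h4] at hs
      have : -t < s := h3.trans_lt hs.1
      simp [orbitSegment, leftShift, this, show ¬ (t + s ≤ 0) by linarith]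
    have hi : ∀ r, 0 ≤ r → IntervalIntegrable (fun s => S s y) volume 0 r := fun r hr =>
      ((hS.continuousOn_orbit y).mono fun s hs => by
        rw [uIcc_of_le hr] at hs; exact hs.1).intervalIntegrable
    rw [e1, intervalIntegral.integral_comp_add_left (fun s => S s y), add_zero,
      hftc (t + σ) (by linarith), hftc t ht.le,
      ← intervalIntegral.integral_interval_sub_left (hi (t + σ) (by linarith)) (hi t ht.le)]
    abel
  by_cases hcase : -t < τ
  · rw [horb τ hcase.le hτ.2]
    simp [orbitSegment, leftShift, hcase, show ¬ (t + τ ≤ 0) by linarith]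
  · push Not at hcase
    have hint : ∀ σ ∈ Icc (-1 : ℝ) 0,
        IntervalIntegrable (fun s => orbitSegment S t y s + leftShift t g s) volume 0 σ := by
      intro σ hσ
      have h : IntegrableOn (fun s => orbitSegment S t y s + leftShift t g s)
          (Icc (-1 : ℝ) 0) volume := (hLp y g).integrable (Fact.out : 1 ≤ p)
      refine intervalIntegrable_iff.2 (h.mono_set ?_)
      rw [uIoc_of_ge hσ.2]
      exact fun r hr => ⟨hσ.1.trans hr.1.le, hr.2⟩
    have ht1 : -t ∈ Icc (-1 : ℝ) 0 := ⟨hτ.1.trans hcase, by linarith⟩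
    rw [← intervalIntegral.integral_add_adjacent_intervals (hint (-t) ht1)
      ((hint (-t) ht1).symm.trans (hint τ hτ)), horb (-t) le_rfl ht1.2]
    have e2 : ∫ s in (-t)..τ, (orbitSegment S t y s + leftShift t g s)
        = ∫ s in (-t)..τ, g (t + s) := by
      apply intervalIntegral.integral_congr_ae
      filter_upwards with s hs
      rw [uIoc_of_ge hcase] at hs
      have h5 : ¬ (-t < s) := not_lt.2 hs.2
      simp [orbitSegment, leftShift, h5, show t + s ≤ 0 by linarith [hs.2]]
    rw [e2, intervalIntegral.integral_comp_add_left (fun s => g s)]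
    have h6 := h2 ⟨by linarith [hτ.1], by linarith⟩
    simp only [orbitSegment, leftShift, not_lt.2 hcase, if_false,
      show t + τ ≤ 0 by linarith, if_true, h6, add_neg_cancel, hS.map_zero, zero_add,
      ContinuousLinearMap.id_apply]
    abel

/-- Condition (K): there is `q : ℝ₊ → ℝ₊` with `q(t) → 0` as `t → 0+` such that
`∫₀ᵗ ‖Φ (S_s x + T₀(s) f)‖ ds ≤ q(t) ‖(x, f)‖` for all `t > 0` and all `(x, f) ∈ D(A) × W^{1,p}`
with `f(0) = x`. For such `(x, f)` the function `S_s x + T₀(s) f` does belong to `W^{1,p}`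
(see `exists_isSegment`); it is the element `w s` below. -/
def ConditionK (S : ℝ → X →L[𝕜] X) (A : X →ₗ.[𝕜] X) (Φ : W1p 𝕜 X p →L[𝕜] X) : Prop :=
  ∃ q : ℝ → ℝ≥0, Tendsto q (𝓝[>] 0) (𝓝 0) ∧
    ∀ z ∈ delayDomain p A, ∀ w : ℝ → W1p 𝕜 X p, (∀ s, 0 < s → IsSegment S z.1 z.2 s (w s)) →
      ∀ t, 0 < t → ∫⁻ s in Ioc 0 t, ‖Φ (w s)‖ₑ ≤ q t * ‖z‖ₑ

end Operators

end DelayEquation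

end

/-!
# Norm continuity of the delay semigroup

The semigroup of the unperturbed equation (`Φ = 0`) is explicit: `delaySemigroup` sends `(x, f)` to
`(S(t) x, S_t x + T₀(t) f)`, the second component being the window `[t - 1, t]` of the trajectory
which continues the history `f` by the orbit of `x`. Its generator is `(x, f) ↦ (A x, f')` with the
coupling `f(0) = x` (`mem_genGraph_delaySemigroup`), and the operator matrix with `Φ` is the
perturbation of this generator by `J C`, where `C (x, f) = Φ f` and `J x = (x, 0)`
(`graph_delayOperator`). Condition (K) says that `C` is an observation whose integrated output is
small over short times, which is the hypothesis of the Miyadera–Voigt theorem.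

The perturbed semigroup `T` (`exists_perturbed_semigroup`) solves the Volterra equation
`T(t) z = T₀(t) z + ∫₀ᵗ T(t - s) J C T₀(s) z ds`. Strongly continuous bounded families of operators
on `Y` are the elements of the Banach space `Y →L[𝕜] (ℝ →ᵇ Y)`. After rescaling the semigroup by
`exp (-ω t)` the right-hand side is a contraction there (`exists_volterra_fixedPoint`), and the
semigroup law holds because its defect solves the homogeneous equation
(`isC0Semigroup_of_volterra`). By the Volterra equation the generator of `T` extends the perturbed
operator. They agree since `λ` minus the generator is injective and `λ` minus the perturbed operator
is surjective for large `λ` (`IsC0Semigroup.genGraph_eq_of_surjective`,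
`perturbedGraph_surjective`).

For norm continuity only the families `t ↦ T(t) J` enter the integral. Since the output is small
over short times uniformly in `z`, the convolution turns norm continuity on `(0, ∞)` of such a
family into norm continuity of the whole integral on `[0, ∞)` (`continuousOn_volterra`). The family
`T₀(t) J x = (S(t) x, S_t x)` is norm continuous on `(0, ∞)`, because `S` is and translation is
continuous in `L^p`; the contraction preserves this property, and so `T(t) J` has it. Hence `T - T₀`
is norm continuous on `[0, ∞)`. Finally, `T₀` itself is norm continuous on `[1, ∞)`, where the
nilpotent shift vanishes. A semigroup is determined by its generator
(`IsC0Semigroup.eq_of_genGraph_le`), so every semigroup generated by the operator matrix is `T`.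
-/

/-! ### Strongly continuous semigroups and their generators -/

namespace DelayEquation

section SemigroupTheory

variable {𝕜 : Type*} [RCLike 𝕜] {Y : Type*} [NormedAddCommGroup Y] [NormedSpace 𝕜 Y]
  {T : ℝ → Y →L[𝕜] Y}

lemma IsC0Semigroup.map_add_apply (hT : IsC0Semigroup T) {s t : ℝ} (hs : 0 ≤ s) (ht : 0 ≤ t)
    (y : Y) : T (s + t) y = T s (T t y) := by
  rw [hT.map_add s t hs ht]; rfl

lemma IsC0Semigroup.map_zero_apply (hT : IsC0Semigroup T) (y : Y) : T 0 y = y := by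
  rw [hT.map_zero]; rfl

lemma IsC0Semigroup.exists_exp_bound [CompleteSpace Y] (hT : IsC0Semigroup T) :
    ∃ M ω : ℝ, 1 ≤ M ∧ 0 ≤ ω ∧ ∀ t, 0 ≤ t → ‖T t‖ ≤ M * Real.exp (ω * t) := by
  obtain ⟨C, hC⟩ := banach_steinhaus (g := fun i : Icc (0 : ℝ) 1 => T i) (fun y => by
    obtain ⟨C, hC⟩ := isCompact_Icc.exists_bound_of_continuousOn
      ((hT.continuousOn_orbit y).mono (Icc_subset_Ici_self : Icc (0 : ℝ) 1 ⊆ Ici 0))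
    exact ⟨C, fun i => hC i i.2⟩)
  set M := max C 1 with hM
  have hM1 : 1 ≤ M := le_max_right _ _
  have h1 : ∀ t ∈ Icc (0 : ℝ) 1, ‖T t‖ ≤ M := fun t ht => (hC ⟨t, ht⟩).trans (le_max_left _ _)
  have hn : ∀ n : ℕ, ∀ t : ℝ, 0 ≤ t → t ≤ n + 1 → ‖T t‖ ≤ M * M ^ n := by
    intro n
    induction n with
    | zero => intro t h0 h; simpa using h1 t ⟨h0, by simpa using h⟩
    | succ n ih =>
      intro t h0 h
      by_cases ht : t ≤ 1
      · exact (h1 t ⟨h0, ht⟩).trans (le_mul_of_one_le_right (by linarith) (one_le_pow₀ hM1))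
      · have h2 := ih (t - 1) (by linarith) (by push_cast at h; linarith)
        have h3 : T t = (T 1).comp (T (t - 1)) := by
          rw [← hT.map_add 1 (t - 1) zero_le_one (by linarith)]; congr 1; ring
        calc ‖T t‖ ≤ ‖T 1‖ * ‖T (t - 1)‖ := by rw [h3]; exact ContinuousLinearMap.opNorm_comp_le _ _
          _ ≤ M * (M * M ^ n) := by
            gcongr
            exact h1 1 ⟨zero_le_one, le_rfl⟩
          _ = M * M ^ (n + 1) := by ring
  refine ⟨M, Real.log M, hM1, Real.log_nonneg hM1, fun t ht => ?_⟩
  refine (hn ⌊t⌋₊ t ht (Nat.lt_floor_add_one t).le).trans ?_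
  gcongr
  rw [← Real.rpow_natCast, Real.rpow_def_of_pos (by linarith)]
  gcongr
  · exact Real.log_nonneg hM1
  · exact Nat.floor_le ht

lemma IsC0Semigroup.exists_bound [CompleteSpace Y] (hT : IsC0Semigroup T) (N : ℝ) :
    ∃ M : ℝ, 1 ≤ M ∧ ∀ t ∈ Icc 0 N, ‖T t‖ ≤ M := by
  obtain ⟨M, ω, hM, hω, h⟩ := hT.exists_exp_bound
  refine ⟨M * Real.exp (ω * max N 0),
    one_le_mul_of_one_le_of_one_le hM (Real.one_le_exp (by positivity)), fun t ht => ?_⟩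
  refine (h t ht.1).trans ?_
  gcongr
  exact ht.2.trans (le_max_left _ _)

/-- The action `(t, y) ↦ T t y` is jointly continuous. -/
lemma IsC0Semigroup.tendsto_apply [CompleteSpace Y] (hT : IsC0Semigroup T) {α : Type*}
    {l : Filter α} {a : α → ℝ} {y : α → Y} {a₀ : ℝ} {y₀ : Y} (h₀ : 0 ≤ a₀)
    (ha : Tendsto a l (𝓝[Ici 0] a₀)) (hy : Tendsto y l (𝓝 y₀)) :
    Tendsto (fun i => T (a i) (y i)) l (𝓝 (T a₀ y₀)) := by
  obtain ⟨M, hM, hb⟩ := hT.exists_bound (a₀ + 1)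
  have h1 : Tendsto (fun i => T (a i) y₀) l (𝓝 (T a₀ y₀)) :=
    (hT.continuousOn_orbit y₀ a₀ h₀).tendsto.comp ha
  have h2 : Tendsto (fun i => T (a i) (y i - y₀)) l (𝓝 0) := by
    have h3 : Tendsto (fun i => M * ‖y i - y₀‖) l (𝓝 0) := by
      have := (tendsto_iff_norm_sub_tendsto_zero.1 hy).const_mul M
      simpa using this
    refine squeeze_zero_norm' ?_ h3
    have h4 : ∀ᶠ i in l, a i ∈ Icc 0 (a₀ + 1) := by
      have h5 : Icc 0 (a₀ + 1) ∈ 𝓝[Ici 0] a₀ :=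
        inter_mem self_mem_nhdsWithin (mem_nhdsWithin_of_mem_nhds (Iic_mem_nhds (by linarith)))
      exact ha h5
    filter_upwards [h4] with i hi
    exact (ContinuousLinearMap.le_opNorm _ _).trans (by gcongr; exact hb _ hi)
  have := h2.add h1
  simpa using this

lemma IsC0Semigroup.continuousOn_apply [CompleteSpace Y] (hT : IsC0Semigroup T) {β : Type*}
    [TopologicalSpace β] {s : Set β} {a : β → ℝ} {y : β → Y} (ha : ContinuousOn a s)
    (h₀ : ∀ i ∈ s, 0 ≤ a i) (hy : ContinuousOn y s) :
    ContinuousOn (fun i => T (a i) (y i)) s := fun i hi =>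
  hT.tendsto_apply (h₀ i hi) (tendsto_nhdsWithin_iff.2 ⟨ha i hi, by
    filter_upwards [self_mem_nhdsWithin] with j hj using h₀ j hj⟩) (hy i hi)

lemma IsC0Semigroup.continuous_orbit (hT : IsC0Semigroup T) (y : Y) :
    Continuous fun t => T (max t 0) y := by
  rw [← continuousOn_univ]
  exact (hT.continuousOn_orbit y).comp (by fun_prop) fun t _ => le_max_right t 0

lemma IsC0Semigroup.intervalIntegrable (hT : IsC0Semigroup T) (y : Y) {a b : ℝ} (ha : 0 ≤ a)
    (hb : 0 ≤ b) : IntervalIntegrable (fun s => T s y) volume a b :=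
  ((hT.continuousOn_orbit y).mono fun _ hs => (le_inf ha hb).trans hs.1).intervalIntegrable

variable [NormedSpace ℝ Y]

/-- Averages of `g h` over `(0, h]` converge to the common limit of the values. -/
lemma tendsto_average {g : ℝ → ℝ → Y} {y : Y} [CompleteSpace Y]
    (hint : ∀ h, 0 < h → IntervalIntegrable (g h) volume 0 h)
    (hg : ∀ ε > 0, ∀ᶠ h in 𝓝[>] (0 : ℝ), ∀ s ∈ Ioc 0 h, ‖g h s - y‖ ≤ ε) :
    Tendsto (fun h : ℝ => h⁻¹ • ∫ s in (0 : ℝ)..h, g h s) (𝓝[>] 0) (𝓝 y) := by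
  rw [tendsto_iff_norm_sub_tendsto_zero, Metric.tendsto_nhds]
  intro ε hε
  filter_upwards [hg (ε / 2) (half_pos hε), self_mem_nhdsWithin] with h hh h0
  simp only [mem_Ioi] at h0
  have e : h⁻¹ • (∫ s in (0 : ℝ)..h, g h s) - y = h⁻¹ • ∫ s in (0 : ℝ)..h, (g h s - y) := by
    rw [intervalIntegral.integral_sub (hint h h0) intervalIntegrable_const, smul_sub,
      intervalIntegral.integral_const, sub_zero, smul_smul, inv_mul_cancel₀ h0.ne', one_smul]
  have h1 : ‖∫ s in (0 : ℝ)..h, (g h s - y)‖ ≤ ε / 2 * |h - 0| :=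
    intervalIntegral.norm_integral_le_of_norm_le_const fun s hs => hh s (by
      rwa [uIoc_of_le h0.le] at hs)
  rw [sub_zero, abs_of_pos h0] at h1
  rw [dist_zero_right, norm_norm, e, norm_smul, norm_inv, Real.norm_of_nonneg h0.le]
  calc h⁻¹ * ‖∫ s in (0 : ℝ)..h, (g h s - y)‖ ≤ h⁻¹ * (ε / 2 * h) := by gcongr
    _ = ε / 2 := by field_simp
    _ < ε := half_lt_self hε

lemma tendsto_average_of_continuousWithinAt [CompleteSpace Y] {g : ℝ → Y}
    (hint : ∀ h, 0 < h → IntervalIntegrable g volume 0 h)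
    (hg : ContinuousWithinAt g (Ici 0) 0) :
    Tendsto (fun h : ℝ => h⁻¹ • ∫ s in (0 : ℝ)..h, g s) (𝓝[>] 0) (𝓝 (g 0)) := by
  refine tendsto_average (g := fun _ => g) hint fun ε hε => ?_
  obtain ⟨δ, hδ, h⟩ := Metric.continuousWithinAt_iff.1 hg ε hε
  filter_upwards [Ioo_mem_nhdsGT hδ] with t ht s hs
  rw [← dist_eq_norm]
  refine (h hs.1.le ?_).le
  rw [Real.dist_eq, sub_zero, abs_of_pos hs.1]
  exact hs.2.trans_lt ht.2

variable [IsScalarTower ℝ 𝕜 Y]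

/-- The graph of the generator of `T`: the pairs `(y, z)` such that `(T h y - y) / h → z` as
`h → 0+`. -/
def genGraph (T : ℝ → Y →L[𝕜] Y) : Submodule 𝕜 (Y × Y) where
  carrier := {v | Tendsto (fun h : ℝ => h⁻¹ • (T h v.1 - v.1)) (𝓝[>] 0) (𝓝 v.2)}
  add_mem' := fun {v w} hv hw => by
    refine (Tendsto.add hv hw).congr fun h => ?_
    simp only [Prod.fst_add, map_add, ← smul_add]
    congr 1
    abel
  zero_mem' := by simp
  smul_mem' := fun c v hv => by
    refine (Tendsto.const_smul hv c).congr fun h => ?_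
    rw [Prod.smul_fst, map_smul, ← smul_sub, smul_comm]

lemma mem_genGraph {v : Y × Y} :
    v ∈ genGraph T ↔ Tendsto (fun h : ℝ => h⁻¹ • (T h v.1 - v.1)) (𝓝[>] 0) (𝓝 v.2) := Iff.rfl

lemma isGenerator_iff {G : Y →ₗ.[𝕜] Y} : IsGenerator T G ↔ G.graph = genGraph T :=
  ⟨fun h => SetLike.ext fun v => h v.1 v.2, fun h y z => by rw [h, mem_genGraph]⟩

lemma genGraph_unique {y z z' : Y} (h : (y, z) ∈ genGraph T) (h' : (y, z') ∈ genGraph T) :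
    z = z' := tendsto_nhds_unique h h'

lemma IsC0Semigroup.apply_mem_genGraph (hT : IsC0Semigroup T) {v : Y × Y} (hv : v ∈ genGraph T)
    {t : ℝ} (ht : 0 ≤ t) : (T t v.1, T t v.2) ∈ genGraph T := by
  refine (((T t).continuous.tendsto v.2).comp hv).congr' ?_
  filter_upwards [self_mem_nhdsWithin] with h hh
  have hh' : 0 ≤ h := le_of_lt hh
  simp only [Function.comp, map_real_smul (T t) (T t).continuous, map_sub]
  rw [← hT.map_add_apply ht hh', ← hT.map_add_apply hh' ht, add_comm]

lemma IsC0Semigroup.hasDerivWithinAt (hT : IsC0Semigroup T) {v : Y × Y} (hv : v ∈ genGraph T)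
    {t : ℝ} (ht : 0 ≤ t) : HasDerivWithinAt (fun s => T s v.1) (T t v.2) (Ici t) t := by
  rw [← hasDerivWithinAt_Ioi_iff_Ici, hasDerivWithinAt_iff_tendsto_slope' self_notMem_Ioi]
  have h2 : Tendsto (fun s : ℝ => s - t) (𝓝[>] t) (𝓝[>] 0) := by
    refine tendsto_nhdsWithin_iff.2 ⟨?_, ?_⟩
    · have : Tendsto (fun s : ℝ => s - t) (𝓝 t) (𝓝 (t - t)) :=
        (continuous_id.sub continuous_const).tendsto t
      rw [sub_self] at this
      exact this.mono_left nhdsWithin_le_nhds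
    · filter_upwards [self_mem_nhdsWithin] with s hs
      simpa using hs
  refine ((hT.apply_mem_genGraph hv ht : Tendsto _ _ _).comp h2).congr' ?_
  filter_upwards [self_mem_nhdsWithin] with s hs
  have hs' : (0 : ℝ) ≤ s - t := by simpa using le_of_lt hs
  simp only [Function.comp, slope, vsub_eq_sub]
  rw [← hT.map_add_apply hs' ht, sub_add_cancel]

variable [CompleteSpace Y]

lemma IsC0Semigroup.apply_eq_add_integral (hT : IsC0Semigroup T) {v : Y × Y}
    (hv : v ∈ genGraph T) {t : ℝ} (ht : 0 ≤ t) : T t v.1 = v.1 + ∫ s in (0 : ℝ)..t, T s v.2 := by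
  rw [intervalIntegral.integral_eq_sub_of_hasDeriv_right (f := fun s => T s v.1)
    ((hT.continuousOn_orbit v.1).mono fun s hs => by rw [uIcc_of_le ht] at hs; exact hs.1)
    (fun s hs => (hT.hasDerivWithinAt hv (by rw [min_eq_left ht] at hs; exact hs.1.le)).mono
      Ioi_subset_Ici_self) (hT.intervalIntegrable _ le_rfl ht), hT.map_zero_apply]
  simp

lemma IsC0Semigroup.mem_genGraph_of_integral (hT : IsC0Semigroup T) {v : Y × Y}
    (hv : ∀ t, 0 < t → T t v.1 = v.1 + ∫ s in (0 : ℝ)..t, T s v.2) : v ∈ genGraph T := by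
  have h := tendsto_average_of_continuousWithinAt
    (fun h hh => hT.intervalIntegrable v.2 le_rfl (le_of_lt hh))
    (hT.continuousOn_orbit v.2 0 self_mem_Ici)
  rw [hT.map_zero_apply] at h
  refine h.congr' ?_
  filter_upwards [self_mem_nhdsWithin] with t ht
  rw [hv t ht, add_sub_cancel_left]

lemma IsC0Semigroup.isClosed_genGraph (hT : IsC0Semigroup T) :
    IsClosed (genGraph T : Set (Y × Y)) := by
  refine IsSeqClosed.isClosed fun v w hv hvw => hT.mem_genGraph_of_integral fun t ht => ?_
  have h1 : Tendsto (fun n => T t (v n).1) atTop (𝓝 (T t w.1)) :=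
    ((T t).continuous.tendsto _).comp ((continuous_fst.tendsto w).comp hvw)
  have h2 : Tendsto (fun n => (v n).1 + ∫ s in (0 : ℝ)..t, T s (v n).2) atTop
      (𝓝 (w.1 + ∫ s in (0 : ℝ)..t, T s w.2)) := by
    refine ((continuous_fst.tendsto w).comp hvw).add ?_
    obtain ⟨M, hM, hb⟩ := hT.exists_bound t
    rw [tendsto_iff_norm_sub_tendsto_zero]
    have h3 : Tendsto (fun n => M * ‖(v n).2 - w.2‖ * |t - 0|) atTop (𝓝 0) := by
      have := (tendsto_iff_norm_sub_tendsto_zero.1 ((continuous_snd.tendsto w).comp hvw))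
      simpa using (this.const_mul M).mul_const |t - 0|
    refine squeeze_zero (fun _ => norm_nonneg _) (fun n => ?_) h3
    rw [← intervalIntegral.integral_sub (hT.intervalIntegrable _ le_rfl ht.le)
      (hT.intervalIntegrable _ le_rfl ht.le)]
    refine intervalIntegral.norm_integral_le_of_norm_le_const fun s hs => ?_
    rw [uIoc_of_le ht.le] at hs
    rw [← map_sub]
    exact (ContinuousLinearMap.le_opNorm _ _).trans (by gcongr; exact hb s ⟨hs.1.le, hs.2⟩)
  refine tendsto_nhds_unique h1 (h2.congr fun n => ?_)
  rw [hT.apply_eq_add_integral (hv n) ht.le]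

lemma IsC0Semigroup.integral_mem_genGraph (hT : IsC0Semigroup T) (y : Y) {t : ℝ} (ht : 0 ≤ t) :
    (∫ s in (0 : ℝ)..t, T s y, T t y - y) ∈ genGraph T := by
  have hint : ∀ h, 0 < h → IntervalIntegrable (fun s => T (t + s) y - T s y) volume 0 h := by
    intro h hh
    refine ContinuousOn.intervalIntegrable ?_
    rw [uIcc_of_le hh.le]
    exact ((hT.continuousOn_orbit y).comp (by fun_prop) fun s hs => add_nonneg ht hs.1).sub
      ((hT.continuousOn_orbit y).mono fun s hs => hs.1)
  have hc : ContinuousWithinAt (fun s => T (t + s) y - T s y) (Ici 0) 0 :=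
    (((hT.continuousOn_orbit y).comp (by fun_prop) fun s hs => add_nonneg ht hs).sub
      (hT.continuousOn_orbit y)) 0 self_mem_Ici
  have h := tendsto_average_of_continuousWithinAt hint hc
  rw [hT.map_zero_apply, add_zero] at h
  refine h.congr' ?_
  filter_upwards [self_mem_nhdsWithin] with h hh
  have hh : 0 < h := hh
  have hi := fun {a b : ℝ} => hT.intervalIntegrable y (a := a) (b := b)
  have hi' : IntervalIntegrable (fun s => T (t + s) y) volume 0 h := by
    refine ContinuousOn.intervalIntegrable ?_
    rw [uIcc_of_le hh.le]
    exact ((hT.continuousOn_orbit y).comp (by fun_prop) fun s hs => add_nonneg ht hs.1)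
  have e1 : T h (∫ s in (0 : ℝ)..t, T s y) = ∫ s in h..(h + t), T s y := by
    have := intervalIntegral.integral_comp_add_left (fun s => T s y) (a := 0) (b := t) h
    rw [add_zero] at this
    rw [← this]
    change ((T h).restrictScalars ℝ) _ = _
    rw [← ContinuousLinearMap.intervalIntegral_comp_comm _ (hi le_rfl ht)]
    refine intervalIntegral.integral_congr fun s hs => ?_
    rw [uIcc_of_le ht] at hs
    exact (hT.map_add_apply hh.le hs.1 y).symm
  congr 1
  rw [e1, intervalIntegral.integral_sub hi' (hi le_rfl hh.le),
    intervalIntegral.integral_comp_add_left (fun s => T s y), add_zero, add_comm t h,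
    intervalIntegral.integral_interval_sub_interval_comm (hi hh.le (by linarith)) (hi le_rfl ht)
      (hi hh.le le_rfl), intervalIntegral.integral_symm (0 : ℝ) h,
    intervalIntegral.integral_symm t (h + t)]
  abel

lemma IsC0Semigroup.denseRange_fst (hT : IsC0Semigroup T) :
    DenseRange (fun v : genGraph T => (v : Y × Y).1) := fun y => by
  have h := tendsto_average_of_continuousWithinAt
    (fun h hh => hT.intervalIntegrable y le_rfl (le_of_lt hh))
    (hT.continuousOn_orbit y 0 self_mem_Ici)
  rw [hT.map_zero_apply] at h
  refine mem_closure_of_tendsto h ?_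
  filter_upwards [self_mem_nhdsWithin] with t ht
  have h1 := (genGraph T).smul_mem ((t⁻¹ : ℝ) : 𝕜) (hT.integral_mem_genGraph y (le_of_lt ht))
  refine ⟨⟨_, h1⟩, ?_⟩
  simp only [Prod.smul_fst]
  rw [← RCLike.real_smul_eq_coe_smul]

omit [CompleteSpace Y] in
lemma IsC0Semigroup.exp_smul (hT : IsC0Semigroup T) (ω : ℝ) :
    IsC0Semigroup (fun t => Real.exp (ω * t) • T t) where
  map_zero := by simp [hT.map_zero]
  map_add s t hs ht := by
    ext y
    simp only [smul_apply, ContinuousLinearMap.comp_apply, mul_add,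
      Real.exp_add, hT.map_add_apply hs ht, map_real_smul (T s) (T s).continuous, mul_smul]
  continuousOn_orbit y := by
    simp only [smul_apply]
    exact ContinuousOn.smul (by fun_prop) (hT.continuousOn_orbit y)

omit [CompleteSpace Y] in
/-- Rescaling a semigroup by `exp (ω t)` adds `ω` to its generator. -/
lemma mem_genGraph_exp_smul {y z : Y} (h : (y, z) ∈ genGraph T) (ω : ℝ) :
    (y, z + ω • y) ∈ genGraph (fun t => Real.exp (ω * t) • T t) := by
  have h1 : Tendsto (fun h : ℝ => Real.exp (ω * h)) (𝓝[>] 0) (𝓝 1) := by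
    have : Continuous fun h : ℝ => Real.exp (ω * h) := by fun_prop
    simpa using (this.tendsto 0).mono_left nhdsWithin_le_nhds
  have h2 : Tendsto (fun h : ℝ => h⁻¹ * (Real.exp (ω * h) - 1)) (𝓝[>] 0) (𝓝 ω) := by
    have hd : HasDerivAt (fun h : ℝ => Real.exp (ω * h)) ω 0 := by
      simpa using ((hasDerivAt_id (0 : ℝ)).const_mul ω).exp
    have := (hasDerivAt_iff_tendsto_slope.1 hd).mono_left
      (nhdsWithin_mono (0 : ℝ) (fun x hx => ne_of_gt hx : Ioi (0 : ℝ) ⊆ {0}ᶜ))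
    refine this.congr fun h => ?_
    simp [slope]
  have h3 := (h1.smul (mem_genGraph.1 h)).add (h2.smul_const y)
  rw [one_smul] at h3
  refine h3.congr fun h => ?_
  simp only [smul_apply, smul_sub, sub_smul, mul_sub, mul_smul, mul_one]
  rw [smul_comm (Real.exp (ω * h)) h⁻¹, smul_comm (Real.exp (ω * h)) h⁻¹]
  abel

/-- A semigroup is determined by its generator. -/
lemma IsC0Semigroup.eq_of_genGraph_le {T' : ℝ → Y →L[𝕜] Y} (hT : IsC0Semigroup T)
    (hT' : IsC0Semigroup T') (hle : genGraph T ≤ genGraph T') {t : ℝ} (ht : 0 ≤ t) :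
    T t = T' t := by
  have key : ∀ v ∈ genGraph T, T t v.1 = T' t v.1 := by
    intro v hv
    have hc : ContinuousOn (fun s => T' (t - s) (T s v.1)) (Icc 0 t) :=
      hT'.continuousOn_apply (by fun_prop) (fun s hs => by linarith [hs.2])
        ((hT.continuousOn_orbit v.1).mono fun s hs => hs.1)
    have hd : ∀ s ∈ Ico 0 t,
        HasDerivWithinAt (fun s => T' (t - s) (T s v.1)) 0 (Ici s) s := by
      intro s hs
      rw [← hasDerivWithinAt_Ioi_iff_Ici, hasDerivWithinAt_iff_tendsto_slope' self_notMem_Ioi]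
      have d1 := hT.hasDerivWithinAt hv hs.1
      have d2 := hT'.hasDerivWithinAt (hle (hT.apply_mem_genGraph hv hs.1)) le_rfl
      rw [← hasDerivWithinAt_Ioi_iff_Ici, hasDerivWithinAt_iff_tendsto_slope' self_notMem_Ioi]
        at d1 d2
      simp only [hT'.map_zero_apply] at d2
      have hsub : Tendsto (fun r : ℝ => r - s) (𝓝[>] s) (𝓝[>] 0) := by
        refine tendsto_nhdsWithin_iff.2 ⟨?_, ?_⟩
        · have : Tendsto (fun r : ℝ => r - s) (𝓝 s) (𝓝 (s - s)) :=
            (continuous_id.sub continuous_const).tendsto s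
          rw [sub_self] at this
          exact this.mono_left nhdsWithin_le_nhds
        · filter_upwards [self_mem_nhdsWithin] with r hr
          simpa using hr
      have d3 := d1.sub (d2.comp hsub)
      rw [sub_self] at d3
      have ha : Tendsto (fun r : ℝ => t - r) (𝓝[>] s) (𝓝[Ici 0] (t - s)) := by
        refine tendsto_nhdsWithin_iff.2 ⟨?_, ?_⟩
        · exact ((continuous_const.sub continuous_id).tendsto s).mono_left nhdsWithin_le_nhds
        · filter_upwards [Ioo_mem_nhdsGT hs.2] with r hr
          simpa using hr.2.le
      have d4 := hT'.tendsto_apply (by linarith [hs.2]) ha d3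
      rw [_root_.map_zero] at d4
      refine d4.congr' ?_
      filter_upwards [Ioo_mem_nhdsGT hs.2] with r hr
      have e : T' (t - s) (T s v.1) = T' (t - r) (T' (r - s) (T s v.1)) := by
        rw [← hT'.map_add_apply (by linarith [hr.2]) (by linarith [hr.1])]
        congr 2
        ring
      simp only [slope, Function.comp, vsub_eq_sub, sub_zero, hT'.map_zero_apply]
      rw [e, ← smul_sub, map_real_smul (T' (t - r)) (T' (t - r)).continuous, ← map_sub]
      congr 2
      abel
    have := constant_of_has_deriv_right_zero hc hd t ⟨ht, le_rfl⟩
    simpa [hT.map_zero_apply, hT'.map_zero_apply] using this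
  exact ContinuousLinearMap.coeFn_injective (hT.denseRange_fst.equalizer (T t).continuous
    (T' t).continuous (funext fun v => key v v.2))

/-- A restriction `Γ` of the generator of `T` for which `λ - Γ` is surjective for arbitrarily large
`λ` is the whole generator, because `λ` minus the generator is injective for large `λ`. -/
lemma IsC0Semigroup.genGraph_eq_of_surjective (hT : IsC0Semigroup T) {Γ : Submodule 𝕜 (Y × Y)}
    (hle : Γ ≤ genGraph T) (hsurj : ∀ Λ : ℝ, ∃ l ≥ Λ, ∀ y, ∃ v ∈ Γ, l • v.1 - v.2 = y) :
    genGraph T = Γ := by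
  refine le_antisymm (fun v hv => ?_) hle
  obtain ⟨M, ω, hM, hω, hb⟩ := hT.exists_exp_bound
  obtain ⟨l, hl, hs⟩ := hsurj (ω + 1)
  obtain ⟨w, hw, hwv⟩ := hs (l • v.1 - v.2)
  have hu := (genGraph T).sub_mem hv (hle hw)
  have e2 : (v - w).2 = l • (v - w).1 := by
    simp only [Prod.fst_sub, Prod.snd_sub, smul_sub]
    rw [sub_eq_sub_iff_add_eq_add] at hwv ⊢
    rw [add_comm v.2, hwv, add_comm]
  have h1 := mem_genGraph_exp_smul (y := (v - w).1) (z := (v - w).2) hu (-l)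
  rw [e2, neg_smul, add_neg_cancel] at h1
  have h2 : ∀ t, 0 ≤ t → ‖(v - w).1‖ ≤ Real.exp (-t) * (M * ‖(v - w).1‖) := by
    intro t ht
    have h3 := (hT.exp_smul (-l)).apply_eq_add_integral h1 ht
    simp only [_root_.map_zero, intervalIntegral.integral_zero, add_zero,
      smul_apply] at h3
    calc ‖(v - w).1‖ = Real.exp (-l * t) * ‖T t (v - w).1‖ := by
          conv_lhs => rw [← h3]
          rw [norm_smul, Real.norm_of_nonneg (Real.exp_nonneg _)]
      _ ≤ Real.exp (-l * t) * (M * Real.exp (ω * t) * ‖(v - w).1‖) := by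
          gcongr
          exact (ContinuousLinearMap.le_opNorm _ _).trans (by gcongr; exact hb t ht)
      _ = Real.exp (-l * t + ω * t) * (M * ‖(v - w).1‖) := by rw [Real.exp_add]; ring
      _ ≤ Real.exp (-t) * (M * ‖(v - w).1‖) := by
          gcongr
          nlinarith
  have h4 : ‖(v - w).1‖ ≤ 0 := by
    have h5 : Tendsto (fun t : ℝ => Real.exp (-t) * (M * ‖(v - w).1‖)) atTop (𝓝 0) := by
      simpa using Real.tendsto_exp_neg_atTop_nhds_zero.mul_const (M * ‖(v - w).1‖)
    exact ge_of_tendsto h5 (by filter_upwards [eventually_ge_atTop 0] with t ht using h2 t ht)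
  have h6 : (v - w).1 = 0 := norm_le_zero_iff.1 h4
  have h7 : v - w = 0 := Prod.ext h6 (by rw [e2, h6, smul_zero]; rfl)
  rwa [sub_eq_zero.1 h7]

end SemigroupTheory
end DelayEquation

/-! ### Volterra equations driven by an observation -/

namespace DelayEquation

section Volterra

open scoped BoundedContinuousFunction

variable {𝕜 : Type*} [RCLike 𝕜] {X : Type*} [NormedAddCommGroup X] [NormedSpace 𝕜 X]
  {Y : Type*} [NormedAddCommGroup Y] [NormedSpace 𝕜 Y]
  {V : Type*} [AddCommGroup V] [Module 𝕜 V]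

/-- An operator on `Y` is bounded by `C` as soon as it is on a dense range. -/
lemma opNorm_le_of_denseRange {Z : Type*} [NormedAddCommGroup Z] [NormedSpace 𝕜 Z]
    {e : V →ₗ[𝕜] Y} (he : DenseRange e) {L : Y →L[𝕜] Z} {C : ℝ} (hC : 0 ≤ C)
    (h : ∀ v, ‖L (e v)‖ ≤ C * ‖e v‖) : ‖L‖ ≤ C :=
  L.opNorm_le_bound hC fun y => he.induction_on y
    (isClosed_le (by fun_prop) (by fun_prop)) h

/-- An `L¹`-admissible observation of the semigroup `R`: to each `v` in a space which parametrises
a dense set of initial values `e v ∈ Y` is assigned an output signal `c v : ℝ → X` whose integral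
over `[0, ∞)` is at most `κ ‖e v‖`, and the output of `R r (e v)` is the output of `e v` from time
`r` on. -/
structure IsObservation (R : ℝ → Y →L[𝕜] Y) (e : V →ₗ[𝕜] Y) (c : V →ₗ[𝕜] (ℝ → X)) (κ : ℝ) :
    Prop where
  nonneg : 0 ≤ κ
  dense : DenseRange e
  continuous : ∀ v, Continuous (c v)
  integral_le : ∀ v t, 0 ≤ t → ∫ s in (0 : ℝ)..t, ‖c v s‖ ≤ κ * ‖e v‖
  shift : ∀ v r, 0 ≤ r → ∃ v', e v' = R r (e v) ∧ ∀ s, 0 ≤ s → c v' s = c v (r + s)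

variable {R : ℝ → Y →L[𝕜] Y} {e : V →ₗ[𝕜] Y} {c : V →ₗ[𝕜] (ℝ → X)} {κ : ℝ}

lemma IsObservation.continuous_integrand (h : IsObservation R e c κ) (F : X →L[𝕜] (ℝ →ᵇ Y))
    (v : V) : Continuous (fun q : ℝ × ℝ => F (c v q.2) (q.1 - q.2)) :=
  continuous_eval.comp₂ (F.continuous.comp ((h.continuous v).comp continuous_snd))
    (continuous_fst.sub continuous_snd)

variable [NormedSpace ℝ Y] [IsScalarTower ℝ 𝕜 Y]

omit [IsScalarTower ℝ 𝕜 Y] in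
lemma IsObservation.norm_convolution_le (h : IsObservation R e c κ) (F : X →L[𝕜] (ℝ →ᵇ Y))
    (v : V) (t : ℝ) : ‖∫ s in (0 : ℝ)..max t 0, F (c v s) (t - s)‖ ≤ κ * ‖F‖ * ‖e v‖ := by
  have hc := (h.continuous v).norm
  calc ‖∫ s in (0 : ℝ)..max t 0, F (c v s) (t - s)‖
      ≤ ∫ s in (0 : ℝ)..max t 0, ‖F‖ * ‖c v s‖ := by
        refine intervalIntegral.norm_integral_le_of_norm_le (le_max_right _ _) ?_
          ((continuous_const.mul hc).intervalIntegrable _ _)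
        exact Eventually.of_forall fun s _ =>
          (BoundedContinuousFunction.norm_coe_le_norm _ _).trans (F.le_opNorm _)
    _ ≤ ‖F‖ * (κ * ‖e v‖) := by
        rw [intervalIntegral.integral_const_mul]
        gcongr
        exact h.integral_le v _ (le_max_right _ _)
    _ = κ * ‖F‖ * ‖e v‖ := by ring

/-- The convolution of the output signal `c v` with the family `F` of operators, as a linear map
in `v`. The times `t < 0` are assigned the value at `t = 0`. -/
noncomputable def volterraAux (h : IsObservation R e c κ) (F : X →L[𝕜] (ℝ →ᵇ Y)) :
    V →ₗ[𝕜] (ℝ →ᵇ Y) where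
  toFun v := BoundedContinuousFunction.ofNormedAddCommGroup
    (fun t => ∫ s in (0 : ℝ)..max t 0, F (c v s) (t - s))
    (intervalIntegral.continuous_parametric_intervalIntegral_of_continuous
      (h.continuous_integrand F v) (by fun_prop))
    (κ * ‖F‖ * ‖e v‖) (h.norm_convolution_le F v)
  map_add' v w := by
    ext t
    have hi := fun u => ((h.continuous_integrand F u).comp (Continuous.prodMk_right t))
    simp only [BoundedContinuousFunction.coe_ofNormedAddCommGroup,
      BoundedContinuousFunction.coe_add, Pi.add_apply, map_add]
    exact intervalIntegral.integral_add ((hi v).intervalIntegrable _ _)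
      ((hi w).intervalIntegrable _ _)
  map_smul' a v := by
    ext t
    simp only [BoundedContinuousFunction.coe_ofNormedAddCommGroup,
      BoundedContinuousFunction.coe_smul, Pi.smul_apply, map_smul, RingHom.id_apply]
    exact intervalIntegral.integral_smul _ _

lemma norm_volterraAux_le (h : IsObservation R e c κ) (F : X →L[𝕜] (ℝ →ᵇ Y)) (v : V) :
    ‖volterraAux h F v‖ ≤ κ * ‖F‖ * ‖e v‖ :=
  BoundedContinuousFunction.norm_ofNormedAddCommGroup_le _
    (mul_nonneg (mul_nonneg h.nonneg (norm_nonneg _)) (norm_nonneg _)) (h.norm_convolution_le F v)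

variable [CompleteSpace Y]

/-- The convolution of the family `F` with the output signal, extended by density to all initial
values: `volterra h F (e v) t = ∫ s in 0..t, F (c v s) (t - s)` for `t ≥ 0`. -/
noncomputable def volterra (h : IsObservation R e c κ) (F : X →L[𝕜] (ℝ →ᵇ Y)) :
    Y →L[𝕜] (ℝ →ᵇ Y) := (volterraAux h F).extendOfNorm e

lemma volterra_apply (h : IsObservation R e c κ) (F : X →L[𝕜] (ℝ →ᵇ Y)) (v : V) {t : ℝ}
    (ht : 0 ≤ t) : volterra h F (e v) t = ∫ s in (0 : ℝ)..t, F (c v s) (t - s) := by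
  rw [volterra, LinearMap.extendOfNorm_eq h.dense ⟨_, norm_volterraAux_le h F⟩]
  change ∫ s in (0 : ℝ)..max t 0, F (c v s) (t - s) = _
  rw [max_eq_left ht]

lemma norm_volterra_le (h : IsObservation R e c κ) (F : X →L[𝕜] (ℝ →ᵇ Y)) :
    ‖volterra h F‖ ≤ κ * ‖F‖ :=
  LinearMap.opNorm_extendOfNorm_le h.dense (mul_nonneg h.nonneg (norm_nonneg _))
    (norm_volterraAux_le h F)

lemma volterra_sub (h : IsObservation R e c κ) (F G : X →L[𝕜] (ℝ →ᵇ Y)) :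
    volterra h (F - G) = volterra h F - volterra h G := by
  refine ContinuousLinearMap.coeFn_injective (h.dense.equalizer (volterra h (F - G)).continuous
    (volterra h F - volterra h G).continuous (funext fun v => ?_))
  simp only [Function.comp, sub_apply, volterra,
    LinearMap.extendOfNorm_eq h.dense ⟨_, norm_volterraAux_le h _⟩]
  ext t
  have hi := fun F => ((h.continuous_integrand F v).comp (Continuous.prodMk_right t))
  exact intervalIntegral.integral_sub ((hi F).intervalIntegrable _ _)
      ((hi G).intervalIntegrable _ _)

/-- The Volterra equation `F = F₀ + volterra h (F ∘ J)` has a solution, by the contraction mapping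
principle; it lies in every closed set which is invariant under the iteration. -/
lemma exists_volterra_fixedPoint (h : IsObservation R e c κ) (hκ : κ < 1) {J : X →L[𝕜] Y}
    (hJ : ‖J‖ ≤ 1) (F₀ : Y →L[𝕜] (ℝ →ᵇ Y)) :
    ∃ F : Y →L[𝕜] (ℝ →ᵇ Y), F = F₀ + volterra h (F.comp J) ∧
      ∀ N : Set (Y →L[𝕜] (ℝ →ᵇ Y)), IsClosed N → F₀ ∈ N →
        (∀ G ∈ N, F₀ + volterra h (G.comp J) ∈ N) → F ∈ N := by
  have hc : ContractingWith ⟨κ, h.nonneg⟩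
      (fun F : Y →L[𝕜] (ℝ →ᵇ Y) => F₀ + volterra h (F.comp J)) := by
    refine ⟨hκ, LipschitzWith.of_dist_le_mul fun F G => ?_⟩
    rw [dist_add_left, dist_eq_norm, dist_eq_norm, ← volterra_sub, ← ContinuousLinearMap.sub_comp]
    refine (norm_volterra_le h _).trans (mul_le_mul_of_nonneg_left ?_ h.nonneg)
    exact (ContinuousLinearMap.opNorm_comp_le _ _).trans
      (mul_le_of_le_one_right (norm_nonneg _) hJ)
  refine ⟨hc.fixedPoint, hc.fixedPoint_isFixedPt.symm, fun N hN h0 hstep => ?_⟩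
  refine hN.mem_of_tendsto (hc.tendsto_iterate_fixedPoint F₀) (Eventually.of_forall fun n => ?_)
  induction n with
  | zero => exact h0
  | succ n ih => rw [Function.iterate_succ_apply']; exact hstep _ ih

/-- The operator `y ↦ F y t`. -/
noncomputable abbrev evalAt (F : Y →L[𝕜] (ℝ →ᵇ Y)) (t : ℝ) : Y →L[𝕜] Y :=
  (BoundedContinuousFunction.evalCLM 𝕜 t).comp F

/-- The solution of the Volterra equation is a semigroup. For fixed `a ≥ 0`, the defect
`s ↦ T (a + s) - T a T s` solves the homogeneous Volterra equation, hence vanishes. -/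
lemma isC0Semigroup_of_volterra (h : IsObservation R e c κ) (hκ : κ < 1) (hR : IsC0Semigroup R)
    {J : X →L[𝕜] Y} (hJ : ‖J‖ ≤ 1) {F : Y →L[𝕜] (ℝ →ᵇ Y)}
    (hF : ∀ v t, 0 ≤ t → F (e v) t = R t (e v) + ∫ s in (0 : ℝ)..t, F (J (c v s)) (t - s)) :
    IsC0Semigroup (evalAt F) := by
  have hi : ∀ v t, Continuous fun s => F (J (c v s)) (t - s) := fun v t =>
    (h.continuous_integrand (F.comp J) v).comp (Continuous.prodMk_right t)
  have hzero : evalAt F 0 = ContinuousLinearMap.id 𝕜 Y := by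
    refine ContinuousLinearMap.coeFn_injective (h.dense.equalizer (evalAt F 0).continuous
      continuous_id (funext fun v => ?_))
    change F (e v) 0 = e v
    rw [hF v 0 le_rfl, hR.map_zero_apply, intervalIntegral.integral_same, add_zero]
  refine ⟨hzero, fun a s ha hs => ?_, fun y => (F y).continuous.continuousOn⟩
  -- the defect of the semigroup law at time `a`
  set D : ℝ → Y →L[𝕜] Y := fun s => evalAt F (a + s) - (evalAt F a).comp (evalAt F s) with hD
  have hev : ∀ t, ‖evalAt F t‖ ≤ ‖F‖ := fun t =>
    ContinuousLinearMap.opNorm_le_bound _ (norm_nonneg _) fun y =>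
      (BoundedContinuousFunction.norm_coe_le_norm _ _).trans (F.le_opNorm _)
  have hDeq : ∀ v s, 0 ≤ s → D s (e v) = ∫ r in (0 : ℝ)..s, D (s - r) (J (c v r)) := by
    intro v s hs
    obtain ⟨v', hv', hc'⟩ := h.shift v s hs
    have e1 : ∫ r in s..(a + s), F (J (c v r)) (a + s - r)
        = F (R s (e v)) a - R a (R s (e v)) := by
      rw [← hv', hF v' a ha, add_sub_cancel_left]
      have := intervalIntegral.integral_comp_add_left
        (fun r => F (J (c v r)) (a + s - r)) (a := 0) (b := a) s
      rw [add_zero, add_comm s a] at this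
      rw [← this]
      refine intervalIntegral.integral_congr fun r hr => ?_
      rw [uIcc_of_le ha] at hr
      simp only [hc' r hr.1]
      congr 1
      ring
    have e2 : F (e v) (a + s) = R a (R s (e v))
        + ((∫ r in (0 : ℝ)..s, F (J (c v r)) (a + s - r))
          + (F (R s (e v)) a - R a (R s (e v)))) := by
      rw [hF v (a + s) (add_nonneg ha hs), hR.map_add_apply ha hs, ← e1,
        intervalIntegral.integral_add_adjacent_intervals ((hi v _).intervalIntegrable _ _)
          ((hi v _).intervalIntegrable _ _)]
    have e3 : F (F (e v) s) a
        = F (R s (e v)) a + ∫ r in (0 : ℝ)..s, F (F (J (c v r)) (s - r)) a := by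
      rw [hF v s hs, map_add, BoundedContinuousFunction.coe_add, Pi.add_apply]
      congr 1
      exact (((evalAt F a).restrictScalars ℝ).intervalIntegral_comp_comm
        ((hi v s).intervalIntegrable _ _)).symm
    change F (e v) (a + s) - F (F (e v) s) a = _
    rw [e2, e3]
    have e4 : ∫ r in (0 : ℝ)..s, D (s - r) (J (c v r))
        = (∫ r in (0 : ℝ)..s, F (J (c v r)) (a + s - r))
          - ∫ r in (0 : ℝ)..s, F (F (J (c v r)) (s - r)) a := by
      have hi' : IntervalIntegrable (fun r => F (F (J (c v r)) (s - r)) a) volume 0 s :=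
        ((evalAt F a).continuous.comp (hi v s)).intervalIntegrable _ _
      rw [← intervalIntegral.integral_sub ((hi v _).intervalIntegrable _ _) hi']
      refine intervalIntegral.integral_congr fun r _ => ?_
      simp only [hD, sub_apply, add_sub_assoc]
      rfl
    rw [e4]
    abel
  have hiter : ∀ B, 0 ≤ B → (∀ s, 0 ≤ s → ‖D s‖ ≤ B) → ∀ s, 0 ≤ s → ‖D s‖ ≤ κ * B := by
    intro B hB hb s hs
    refine opNorm_le_of_denseRange h.dense (mul_nonneg h.nonneg hB) fun v => ?_
    rw [hDeq v s hs]
    calc ‖∫ r in (0 : ℝ)..s, D (s - r) (J (c v r))‖ ≤ ∫ r in (0 : ℝ)..s, B * ‖c v r‖ := by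
          refine intervalIntegral.norm_integral_le_of_norm_le hs (Eventually.of_forall
            fun r hr => ?_) ((continuous_const.mul (h.continuous v).norm).intervalIntegrable _ _)
          refine (ContinuousLinearMap.le_opNorm _ _).trans ?_
          gcongr
          · exact hb _ (by linarith [hr.2])
          · exact (J.le_opNorm _).trans (mul_le_of_le_one_left (norm_nonneg _) hJ)
      _ = B * ∫ r in (0 : ℝ)..s, ‖c v r‖ := intervalIntegral.integral_const_mul _ _
      _ ≤ B * (κ * ‖e v‖) := by gcongr; exact h.integral_le v s hs
      _ = κ * B * ‖e v‖ := by ring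
  set B := ‖F‖ + ‖F‖ * ‖F‖ with hB
  have hB0 : 0 ≤ B := by positivity
  have hpow : ∀ n : ℕ, ∀ s, 0 ≤ s → ‖D s‖ ≤ κ ^ n * B := by
    intro n
    induction n with
    | zero =>
      intro s _
      rw [pow_zero, one_mul]
      refine (norm_sub_le _ _).trans (add_le_add (hev _) ?_)
      exact (ContinuousLinearMap.opNorm_comp_le _ _).trans
        (mul_le_mul (hev _) (hev _) (norm_nonneg _) (norm_nonneg _))
    | succ n ih =>
      intro s hs
      refine (hiter _ (mul_nonneg (pow_nonneg h.nonneg n) hB0) ih s hs).trans_eq ?_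
      ring
  have hlim : Tendsto (fun n : ℕ => κ ^ n * B) atTop (𝓝 0) := by
    simpa using (tendsto_pow_atTop_nhds_zero_of_lt_one h.nonneg hκ).mul_const B
  have : D s = 0 := norm_le_zero_iff.1 (ge_of_tendsto' hlim fun n => hpow n s hs)
  exact sub_eq_zero.1 this

/-- If the observation is uniformly small over short times, then convolution with the output turns
a family of operators which is norm continuous on `(0, ∞)` into one which is norm continuous on
`[0, ∞)`. -/
lemma continuousOn_volterra (h : IsObservation R e c κ) {M : ℝ} (hM : ∀ t, 0 ≤ t → ‖R t‖ ≤ M)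
    (hsmall : ∀ ε > 0, ∃ δ > 0, ∀ v, ∫ s in (0 : ℝ)..δ, ‖c v s‖ ≤ ε * ‖e v‖)
    {F : X →L[𝕜] (ℝ →ᵇ Y)}
    (hF : ContinuousOn (fun t => (BoundedContinuousFunction.evalCLM 𝕜 t).comp F) (Ioi 0)) :
    ContinuousOn (evalAt (volterra h F)) (Ici 0) := by
  have hM0 : 0 ≤ M := (norm_nonneg _).trans (hM 0 le_rfl)
  have hn : ∀ v a b, IntervalIntegrable (fun s => ‖c v s‖) volume a b := fun v a b =>
    (h.continuous v).norm.intervalIntegrable a b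
  -- the output is small over short time windows anywhere
  have hwin : ∀ ε > 0, ∃ δ > 0, ∀ v a b, 0 ≤ a → a ≤ b → b ≤ a + δ →
      ∫ s in a..b, ‖c v s‖ ≤ ε * ‖e v‖ := by
    intro ε hε
    obtain ⟨δ, hδ, hs⟩ := hsmall (ε / (M + 1)) (by positivity)
    refine ⟨δ, hδ, fun v a b ha hab hb => ?_⟩
    obtain ⟨v', hv', hc'⟩ := h.shift v a ha
    have e1 : ∫ s in a..b, ‖c v s‖ = ∫ s in (0 : ℝ)..(b - a), ‖c v' s‖ := by
      have := intervalIntegral.integral_comp_add_left (fun s => ‖c v s‖) (a := 0) (b := b - a) a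
      rw [add_zero, add_sub_cancel] at this
      rw [← this]
      refine intervalIntegral.integral_congr fun r hr => ?_
      rw [uIcc_of_le (by linarith)] at hr
      simp only [hc' r hr.1]
    have e2 : ∫ s in (0 : ℝ)..(b - a), ‖c v' s‖ ≤ ∫ s in (0 : ℝ)..δ, ‖c v' s‖ :=
      intervalIntegral.integral_mono_interval le_rfl (by linarith) (by linarith)
        (Eventually.of_forall fun _ => norm_nonneg _) (hn v' _ _)
    calc _ ≤ ε / (M + 1) * ‖e v'‖ := (e1.trans_le e2).trans (hs v')
      _ ≤ ε / (M + 1) * (M * ‖e v‖) := by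
          rw [hv']
          gcongr
          exact (ContinuousLinearMap.le_opNorm _ _).trans (by gcongr; exact hM a ha)
      _ = ε * (M / (M + 1)) * ‖e v‖ := by ring
      _ ≤ ε * 1 * ‖e v‖ := by
          gcongr
          rw [div_le_one (by linarith)]
          linarith
      _ = ε * ‖e v‖ := by ring
  -- uniform continuity on `[0, N]`
  have hunif : ∀ N, ∀ ε > 0, ∃ η > 0, ∀ t₁ t₂, 0 ≤ t₁ → t₁ ≤ t₂ → t₂ ≤ N → t₂ - t₁ < η →
      ‖evalAt (volterra h F) t₂ - evalAt (volterra h F) t₁‖ ≤ ε := by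
    intro N ε hε
    have hκ := h.nonneg
    obtain ⟨δ, hδ, hw⟩ := hwin (ε / (6 * (‖F‖ + 1))) (by positivity)
    have huc := isCompact_Icc.uniformContinuousOn_of_continuous
      (hF.mono (fun r hr => hδ.trans_le hr.1 : Icc δ N ⊆ Ioi 0))
    obtain ⟨η, hη, hu⟩ := Metric.uniformContinuousOn_iff.1 huc (ε / (2 * (κ + 1))) (by positivity)
    refine ⟨min δ η, lt_min hδ hη, fun t₁ t₂ h1 h12 h2 h12' => ?_⟩
    refine opNorm_le_of_denseRange h.dense hε.le fun v => ?_
    have hi : ∀ t, Continuous fun s => F (c v s) (t - s) := fun t =>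
      (h.continuous_integrand F v).comp (Continuous.prodMk_right t)
    have hb : ∀ t s, ‖F (c v s) t‖ ≤ ‖F‖ * ‖c v s‖ := fun t s =>
      (BoundedContinuousFunction.norm_coe_le_norm _ _).trans (F.le_opNorm _)
    set a := max (t₁ - δ) 0 with ha
    have ha0 : 0 ≤ a := le_max_right _ _
    have hat : a ≤ t₁ := max_le (by linarith) h1
    have e0 : (evalAt (volterra h F) t₂ - evalAt (volterra h F) t₁) (e v)
        = (∫ s in (0 : ℝ)..a, (F (c v s) (t₂ - s) - F (c v s) (t₁ - s)))
          + (∫ s in a..t₁, (F (c v s) (t₂ - s) - F (c v s) (t₁ - s)))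
          + ∫ s in t₁..t₂, F (c v s) (t₂ - s) := by
      have hd : ∀ b b', IntervalIntegrable (fun s => F (c v s) (t₂ - s) - F (c v s) (t₁ - s))
          volume b b' := fun b b' => ((hi t₂).sub (hi t₁)).intervalIntegrable _ _
      change volterra h F (e v) t₂ - volterra h F (e v) t₁ = _
      rw [volterra_apply h F v h1, volterra_apply h F v (h1.trans h12),
        intervalIntegral.integral_add_adjacent_intervals (hd _ _) (hd _ _),
        intervalIntegral.integral_sub ((hi t₂).intervalIntegrable _ _)
          ((hi t₁).intervalIntegrable _ _),
        ← intervalIntegral.integral_add_adjacent_intervals (b := t₁)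
          ((hi t₂).intervalIntegrable _ _) ((hi t₂).intervalIntegrable _ _)]
      abel
    -- away from `s = t₁` the family `F` is uniformly continuous, near `s = t₁` the output is small
    have b1 : ‖∫ s in (0 : ℝ)..a, (F (c v s) (t₂ - s) - F (c v s) (t₁ - s))‖
        ≤ ε / (2 * (κ + 1)) * (κ * ‖e v‖) := by
      calc _ ≤ ∫ s in (0 : ℝ)..a, ε / (2 * (κ + 1)) * ‖c v s‖ := by
            refine intervalIntegral.norm_integral_le_of_norm_le ha0 (Eventually.of_forall
              fun s hs => ?_) ((hn v _ _).const_mul _)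
            have hs' : s ≤ t₁ - δ := by
              rcases le_max_iff.1 hs.2 with h' | h'
              · exact h'
              · exact absurd h' (not_le.2 hs.1)
            have hd := hu (t₂ - s) ⟨by linarith, by linarith [hs.1]⟩ (t₁ - s)
              ⟨by linarith, by linarith [hs.1]⟩ (by
                rw [Real.dist_eq, sub_sub_sub_cancel_right, abs_of_nonneg (by linarith)]
                exact h12'.trans_le (min_le_right _ _))
            rw [dist_eq_norm] at hd
            exact (ContinuousLinearMap.le_opNorm
              ((BoundedContinuousFunction.evalCLM 𝕜 (t₂ - s)).comp F
                - (BoundedContinuousFunction.evalCLM 𝕜 (t₁ - s)).comp F) (c v s)).trans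
              (by gcongr)
        _ ≤ _ := by
            rw [intervalIntegral.integral_const_mul]
            gcongr
            exact h.integral_le v a ha0
    have b2 : ‖∫ s in a..t₁, (F (c v s) (t₂ - s) - F (c v s) (t₁ - s))‖
        ≤ 2 * ‖F‖ * (ε / (6 * (‖F‖ + 1)) * ‖e v‖) := by
      calc _ ≤ ∫ s in a..t₁, 2 * ‖F‖ * ‖c v s‖ := by
            refine intervalIntegral.norm_integral_le_of_norm_le hat (Eventually.of_forall
              fun s hs => ?_) ((hn v _ _).const_mul _)
            exact (norm_sub_le _ _).trans (by linarith [hb (t₂ - s) s, hb (t₁ - s) s])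
        _ ≤ _ := by
            rw [intervalIntegral.integral_const_mul]
            gcongr
            exact hw v a t₁ ha0 hat (by linarith [le_max_left (t₁ - δ) 0])
    have b3 : ‖∫ s in t₁..t₂, F (c v s) (t₂ - s)‖
        ≤ ‖F‖ * (ε / (6 * (‖F‖ + 1)) * ‖e v‖) := by
      calc _ ≤ ∫ s in t₁..t₂, ‖F‖ * ‖c v s‖ :=
            intervalIntegral.norm_integral_le_of_norm_le h12 (Eventually.of_forall
              fun s _ => hb _ _) ((hn v _ _).const_mul _)
        _ ≤ _ := by
            rw [intervalIntegral.integral_const_mul]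
            gcongr
            exact hw v t₁ t₂ h1 h12 (by linarith [min_le_left δ η])
    rw [e0]
    refine (norm_add₃_le).trans ((add_le_add_three b1 b2 b3).trans ?_)
    have q1 : ε / (2 * (κ + 1)) * κ ≤ ε / 2 := by
      rw [div_mul_eq_mul_div, div_le_div_iff₀ (by positivity) (by positivity)]
      nlinarith
    have q2 : 3 * ‖F‖ * (ε / (6 * (‖F‖ + 1))) ≤ ε / 2 := by
      rw [mul_div_assoc', div_le_div_iff₀ (by positivity) (by positivity)]
      nlinarith [norm_nonneg F]
    nlinarith [norm_nonneg (e v)]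
  intro t₀ ht₀
  rw [Metric.continuousWithinAt_iff]
  intro ε hε
  obtain ⟨η, hη, hu⟩ := hunif (t₀ + 1) (ε / 2) (half_pos hε)
  refine ⟨min η 1, lt_min hη one_pos, fun t ht htd => ?_⟩
  rw [Real.dist_eq] at htd
  have hd1 := htd.trans_le (min_le_left _ _)
  have hd2 := (abs_lt.1 (htd.trans_le (min_le_right _ _))).2
  rcases le_total t t₀ with hle | hle
  · rw [dist_comm, dist_eq_norm]
    rw [abs_sub_comm, abs_of_nonneg (by linarith)] at hd1
    exact (hu t t₀ ht hle (by linarith) hd1).trans_lt (half_lt_self hε)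
  · rw [dist_eq_norm]
    rw [abs_of_nonneg (by linarith)] at hd1
    exact (hu t₀ t ht₀ hle (by linarith) hd1).trans_lt (half_lt_self hε)

end Volterra

end DelayEquation

/-! ### Miyadera–Voigt perturbations -/

namespace DelayEquation

section MiyaderaVoigt

open scoped BoundedContinuousFunction

variable {𝕜 : Type*} [RCLike 𝕜] {X : Type*} [NormedAddCommGroup X] [NormedSpace 𝕜 X]
  {Y : Type*} [NormedAddCommGroup Y] [NormedSpace 𝕜 Y]

section Output

variable {Γ : Submodule 𝕜 (Y × Y)} {R : ℝ → Y →L[𝕜] Y}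

/-- The orbit of an element `v` of `Γ ⊆ Y × Y` under `R` acting diagonally. -/
def graphOrbit (hΓ : ∀ v ∈ Γ, ∀ t, 0 ≤ t → (R t v.1, R t v.2) ∈ Γ) (v : Γ) (t : ℝ) : Γ :=
  ⟨(R (max t 0) v.1.1, R (max t 0) v.1.2), hΓ v v.2 _ (le_max_right _ _)⟩

lemma graphOrbit_of_nonneg (hΓ : ∀ v ∈ Γ, ∀ t, 0 ≤ t → (R t v.1, R t v.2) ∈ Γ) (v : Γ) {t : ℝ}
    (ht : 0 ≤ t) : graphOrbit hΓ v t = ⟨(R t v.1.1, R t v.1.2), hΓ v v.2 t ht⟩ := by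
  simp only [graphOrbit, max_eq_left ht]

lemma continuous_graphOrbit (hR : IsC0Semigroup R)
    (hΓ : ∀ v ∈ Γ, ∀ t, 0 ≤ t → (R t v.1, R t v.2) ∈ Γ) (v : Γ) :
    Continuous (graphOrbit hΓ v) :=
  ((hR.continuous_orbit v.1.1).prodMk (hR.continuous_orbit v.1.2)).subtype_mk _

/-- The output signal `t ↦ C (R t v)`. -/
def output (hΓ : ∀ v ∈ Γ, ∀ t, 0 ≤ t → (R t v.1, R t v.2) ∈ Γ) (C : Γ →L[𝕜] X) :
    Γ →ₗ[𝕜] (ℝ → X) where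
  toFun v t := C (graphOrbit hΓ v t)
  map_add' v w := by
    funext t
    rw [Pi.add_apply, ← map_add]
    congr 1
    ext <;> simp [graphOrbit]
  map_smul' a v := by
    funext t
    rw [Pi.smul_apply, RingHom.id_apply, ← map_smul]
    congr 1
    ext <;> simp [graphOrbit]

lemma output_apply (hΓ : ∀ v ∈ Γ, ∀ t, 0 ≤ t → (R t v.1, R t v.2) ∈ Γ) (C : Γ →L[𝕜] X) (v : Γ)
    (t : ℝ) : output hΓ C v t = C (graphOrbit hΓ v t) := rfl

lemma continuous_output (hR : IsC0Semigroup R)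
    (hΓ : ∀ v ∈ Γ, ∀ t, 0 ≤ t → (R t v.1, R t v.2) ∈ Γ) (C : Γ →L[𝕜] X) (v : Γ) :
    Continuous (output hΓ C v) := C.continuous.comp (continuous_graphOrbit hR hΓ v)

lemma output_graphOrbit (hR : IsC0Semigroup R)
    (hΓ : ∀ v ∈ Γ, ∀ t, 0 ≤ t → (R t v.1, R t v.2) ∈ Γ) (C : Γ →L[𝕜] X) (v : Γ) {r s : ℝ}
    (hr : 0 ≤ r) (hs : 0 ≤ s) :
    output hΓ C (graphOrbit hΓ v r) s = output hΓ C v (r + s) := by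
  simp only [output_apply]
  rw [add_comm r s, graphOrbit_of_nonneg hΓ _ hr, graphOrbit_of_nonneg hΓ _ hs,
    graphOrbit_of_nonneg hΓ _ (add_nonneg hs hr)]
  congr 1
  simp only [hR.map_add_apply hs hr]

/-- A short-time bound on the output, with constant `κ < 1`, propagates to all times if the
semigroup is sufficiently contractive. -/
lemma isObservation_output (hR : IsC0Semigroup R)
    (hΓ : ∀ v ∈ Γ, ∀ t, 0 ≤ t → (R t v.1, R t v.2) ∈ Γ) (C : Γ →L[𝕜] X)
    (hd : DenseRange ((LinearMap.fst 𝕜 Y Y).comp Γ.subtype)) {t₀ κ : ℝ} (ht₀ : 0 < t₀)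
    (hκ0 : 0 ≤ κ) (hκ : κ < 1)
    (hb : ∀ v, ∫ s in (0 : ℝ)..t₀, ‖output hΓ C v s‖ ≤ κ * ‖(v : Y × Y).1‖)
    (hRt : ‖R t₀‖ ≤ (1 - κ) / 2) :
    IsObservation R ((LinearMap.fst 𝕜 Y Y).comp Γ.subtype) (output hΓ C) ((1 + κ) / 2) := by
  have hi : ∀ v a b, IntervalIntegrable (fun s => ‖output hΓ C v s‖) volume a b := fun v a b =>
    (continuous_output hR hΓ C v).norm.intervalIntegrable a b
  have hn : ∀ n : ℕ, ∀ (v : Γ) (t : ℝ), 0 ≤ t → t ≤ n * t₀ →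
      ∫ s in (0 : ℝ)..t, ‖output hΓ C v s‖ ≤ (1 + κ) / 2 * ‖(v : Y × Y).1‖ := by
    intro n
    induction n with
    | zero =>
      intro v t h0 h1
      obtain rfl : t = 0 := le_antisymm (by simpa using h1) h0
      rw [intervalIntegral.integral_same]
      positivity
    | succ n ih =>
      intro v t h0 h1
      rcases le_total t t₀ with h | h
      · refine (intervalIntegral.integral_mono_interval le_rfl h0 h
          (Eventually.of_forall fun _ => norm_nonneg _) (hi v _ _)).trans ((hb v).trans ?_)
        gcongr
        linarith
      · have e1 : ∫ s in t₀..t, ‖output hΓ C v s‖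
            = ∫ s in (0 : ℝ)..(t - t₀), ‖output hΓ C (graphOrbit hΓ v t₀) s‖ := by
          have := intervalIntegral.integral_comp_add_left (fun s => ‖output hΓ C v s‖)
            (a := 0) (b := t - t₀) t₀
          rw [add_zero, add_sub_cancel] at this
          rw [← this]
          refine intervalIntegral.integral_congr fun r hr => ?_
          rw [uIcc_of_le (by linarith)] at hr
          simp only [output_graphOrbit hR hΓ C v ht₀.le hr.1]
        rw [← intervalIntegral.integral_add_adjacent_intervals (hi v 0 t₀) (hi v t₀ t), e1]
        have h2 := ih (graphOrbit hΓ v t₀) (t - t₀) (by linarith) (by push_cast at h1; linarith)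
        have h3 : ‖((graphOrbit hΓ v t₀ : Γ) : Y × Y).1‖ ≤ (1 - κ) / 2 * ‖(v : Y × Y).1‖ := by
          rw [graphOrbit_of_nonneg hΓ v ht₀.le]
          exact (ContinuousLinearMap.le_opNorm _ _).trans (by gcongr)
        calc _ ≤ κ * ‖(v : Y × Y).1‖ + (1 + κ) / 2 * ((1 - κ) / 2 * ‖(v : Y × Y).1‖) :=
              add_le_add (hb v) (h2.trans (by gcongr))
          _ = (κ + (1 + κ) / 2 * ((1 - κ) / 2)) * ‖(v : Y × Y).1‖ := by ring
          _ ≤ (1 + κ) / 2 * ‖(v : Y × Y).1‖ := by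
              gcongr
              nlinarith
  refine ⟨by linarith, hd, continuous_output hR hΓ C, fun v t ht => ?_, fun v r hr => ?_⟩
  · obtain ⟨n, hn'⟩ := exists_nat_ge (t / t₀)
    exact hn n v t ht ((div_le_iff₀ ht₀).1 hn')
  · refine ⟨graphOrbit hΓ v r, ?_, fun s hs => output_graphOrbit hR hΓ C v hr hs⟩
    rw [graphOrbit_of_nonneg hΓ v hr]
    rfl

end Output

/-- The families of operators which become norm continuous on `(0, ∞)` after composition with `J`
form a closed set: norm convergence in `Y →L[𝕜] (ℝ →ᵇ Y)` is uniform in time. -/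
lemma isClosed_setOf_continuousOn (J : X →L[𝕜] Y) :
    IsClosed {G : Y →L[𝕜] (ℝ →ᵇ Y) |
      ContinuousOn (fun t => (BoundedContinuousFunction.evalCLM 𝕜 t).comp (G.comp J)) (Ioi 0)} := by
  refine IsSeqClosed.isClosed fun G F hG hGF => ?_
  have hu : TendstoUniformlyOn
      (fun n t => (BoundedContinuousFunction.evalCLM 𝕜 t).comp ((G n).comp J))
      (fun t => (BoundedContinuousFunction.evalCLM 𝕜 t).comp (F.comp J)) atTop (Ioi 0) := by
    rw [Metric.tendstoUniformlyOn_iff]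
    intro ε hε
    have h1 : Tendsto (fun n => ‖G n - F‖ * ‖J‖) atTop (𝓝 0) := by
      simpa using (tendsto_iff_norm_sub_tendsto_zero.1 hGF).mul_const ‖J‖
    filter_upwards [h1.eventually_lt_const hε] with n hn t _
    rw [dist_comm, dist_eq_norm]
    refine lt_of_le_of_lt (ContinuousLinearMap.opNorm_le_bound _ (by positivity) fun x => ?_) hn
    calc _ = ‖((G n - F) (J x)) t‖ := rfl
      _ ≤ ‖G n - F‖ * ‖J x‖ :=
        (BoundedContinuousFunction.norm_coe_le_norm _ _).trans ((G n - F).le_opNorm _)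
      _ ≤ ‖G n - F‖ * (‖J‖ * ‖x‖) := by gcongr; exact J.le_opNorm x
      _ = ‖G n - F‖ * ‖J‖ * ‖x‖ := by ring
  exact hu.continuousOn (Eventually.of_forall hG).frequently

lemma norm_apply_max_le {R : ℝ → Y →L[𝕜] Y} {M : ℝ} (hM : ∀ t, 0 ≤ t → ‖R t‖ ≤ M) (y : Y)
    (t : ℝ) : ‖R (max t 0) y‖ ≤ M * ‖y‖ :=
  (ContinuousLinearMap.le_opNorm _ _).trans (by gcongr; exact hM _ (le_max_right _ _))

/-- A bounded strongly continuous semigroup, as an operator into the bounded continuous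
functions. -/
noncomputable def orbitMap {R : ℝ → Y →L[𝕜] Y} (hR : IsC0Semigroup R) {M : ℝ}
    (hM : ∀ t, 0 ≤ t → ‖R t‖ ≤ M) : Y →L[𝕜] (ℝ →ᵇ Y) :=
  LinearMap.mkContinuous
    { toFun := fun y => BoundedContinuousFunction.ofNormedAddCommGroup (fun t => R (max t 0) y)
        (hR.continuous_orbit y) (M * ‖y‖) (norm_apply_max_le hM y)
      map_add' := fun y z => by ext t; simp
      map_smul' := fun a y => by ext t; simp }
    M fun y => BoundedContinuousFunction.norm_ofNormedAddCommGroup_le _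
      (mul_nonneg ((norm_nonneg _).trans (hM 0 le_rfl)) (norm_nonneg y)) (norm_apply_max_le hM y)

lemma orbitMap_apply {R : ℝ → Y →L[𝕜] Y} (hR : IsC0Semigroup R) {M : ℝ}
    (hM : ∀ t, 0 ≤ t → ‖R t‖ ≤ M) (y : Y) {t : ℝ} (ht : 0 ≤ t) : orbitMap hR hM y t = R t y := by
  change R (max t 0) y = R t y
  rw [max_eq_left ht]

variable [NormedSpace ℝ Y] [IsScalarTower ℝ 𝕜 Y] {T₀ : ℝ → Y →L[𝕜] Y}

/-- The graph of the perturbed operator `G + J C`, where `G` is the generator of `T₀`, and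
`C` is bounded for the graph norm of `G`. -/
def perturbedGraph (C : genGraph T₀ →L[𝕜] X) (J : X →L[𝕜] Y) : Submodule 𝕜 (Y × Y) :=
  LinearMap.range (((LinearMap.fst 𝕜 Y Y).comp (genGraph T₀).subtype).prod
    ((LinearMap.snd 𝕜 Y Y).comp (genGraph T₀).subtype + (J.comp C).toLinearMap))

lemma mem_perturbedGraph {C : genGraph T₀ →L[𝕜] X} {J : X →L[𝕜] Y} {w : Y × Y} :
    w ∈ perturbedGraph C J ↔ ∃ v : genGraph T₀, ((v : Y × Y).1, (v : Y × Y).2 + J (C v)) = w :=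
  Iff.rfl

variable [CompleteSpace Y]

/-- A semigroup given by the variation of constants formula has a generator extending `G + J C`. -/
lemma perturbedGraph_le_of_duhamel (hT₀ : IsC0Semigroup T₀) {T : ℝ → Y →L[𝕜] Y}
    (hT : IsC0Semigroup T) {C : genGraph T₀ →L[𝕜] X} {J : X →L[𝕜] Y}
    (h : ∀ (v : genGraph T₀) t, 0 ≤ t → T t (v : Y × Y).1 = T₀ t (v : Y × Y).1
      + ∫ s in (0 : ℝ)..t, T (t - s) (J (output (fun _ hv _ => hT₀.apply_mem_genGraph hv) C v s))) :
    perturbedGraph C J ≤ genGraph T := by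
  rintro w hw
  obtain ⟨v, rfl⟩ := mem_perturbedGraph.1 hw
  set c := output (fun _ hv _ => hT₀.apply_mem_genGraph hv) C v with hc
  have hcc : Continuous c := continuous_output hT₀ _ C v
  have hjoint : Continuous fun r : ℝ × ℝ => T (max r.1 0) (J (c r.2)) := by
    rw [← continuousOn_univ]
    exact hT.continuousOn_apply (by fun_prop) (fun _ _ => le_max_right _ _)
      (J.continuous.comp (hcc.comp continuous_snd)).continuousOn
  have h0 : J (c 0) = J (C v) := by
    rw [hc, output_apply, graphOrbit_of_nonneg _ _ le_rfl]
    congr 2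
    ext <;> simp [hT₀.map_zero_apply]
  have havg : Tendsto (fun r : ℝ => r⁻¹ • ∫ s in (0 : ℝ)..r, T (max (r - s) 0) (J (c s)))
      (𝓝[>] 0) (𝓝 (J (C v))) := by
    refine tendsto_average (g := fun r s => T (max (r - s) 0) (J (c s))) (fun r _ => ?_) ?_
    · exact (hjoint.comp (by fun_prop : Continuous fun s : ℝ => (r - s, s))).intervalIntegrable _ _
    · intro ε hε
      obtain ⟨δ, hδ, hd⟩ := Metric.continuous_iff.1 hjoint (0, 0) ε hε
      filter_upwards [Ioo_mem_nhdsGT hδ] with r hr s hs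
      have := hd (r - s, s) (by
        rw [Prod.dist_eq, Real.dist_eq, Real.dist_eq, sub_zero, sub_zero, max_lt_iff,
          abs_of_nonneg (by linarith [hs.2]), abs_of_pos hs.1]
        exact ⟨by linarith [hs.1, hr.2], hs.2.trans_lt hr.2⟩)
      simp only [max_self, hT.map_zero_apply, dist_eq_norm] at this
      rw [h0] at this
      exact this.le
  rw [mem_genGraph]
  refine ((mem_genGraph.1 v.2).add havg).congr' ?_
  filter_upwards [self_mem_nhdsWithin] with r hr
  have hr : 0 < r := hr
  rw [h v r hr.le, ← smul_add, add_sub_right_comm]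
  congr 2
  refine intervalIntegral.integral_congr fun s hs => ?_
  rw [uIcc_of_le hr.le] at hs
  simp only [max_eq_left (sub_nonneg.2 hs.2), hc]

variable [NormedSpace ℝ X] [IsScalarTower ℝ 𝕜 X] [CompleteSpace X]

/-- The operator `l - G - J C` is surjective. Integrating the rescaled semigroup `exp (-l t) T₀ t`
over `[0, t₀]` inverts `l - G` up to `1 - exp (-l t₀) T₀ t₀`, and `C` of this integral has norm at
most `κ`, so that a Neumann series finishes the proof. -/
lemma perturbedGraph_surjective (hT₀ : IsC0Semigroup T₀) {C : genGraph T₀ →L[𝕜] X}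
    {J : X →L[𝕜] Y} (hJ : ‖J‖ ≤ 1) {t₀ κ l : ℝ} (ht₀ : 0 < t₀) (hκ0 : 0 ≤ κ) (hl : 0 ≤ l)
    (hb : ∀ v, ∫ s in (0 : ℝ)..t₀, ‖output (fun _ hv _ => hT₀.apply_mem_genGraph hv) C v s‖
      ≤ κ * ‖(v : Y × Y).1‖) (hsmall : ‖Real.exp (-l * t₀) • T₀ t₀‖ + κ < 1) (y : Y) :
    ∃ v ∈ perturbedGraph C J, l • v.1 - v.2 = y := by
  set R : ℝ → Y →L[𝕜] Y := fun t => Real.exp (-l * t) • T₀ t with hR'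
  have hR : IsC0Semigroup R := hT₀.exp_smul (-l)
  have hmem : ∀ x, (∫ s in (0 : ℝ)..t₀, R s x,
      R t₀ x - x + l • ∫ s in (0 : ℝ)..t₀, R s x) ∈ genGraph T₀ := by
    intro x
    have h1 := mem_genGraph_exp_smul (hR.integral_mem_genGraph x ht₀.le) l
    have e : (fun t => Real.exp (l * t) • R t) = T₀ := by
      funext t
      rw [hR', smul_smul, ← Real.exp_add, neg_mul, add_neg_cancel, Real.exp_zero, one_smul]
    rwa [e] at h1
  obtain ⟨M, hM, hMb⟩ := hR.exists_bound t₀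
  -- the integral of the rescaled semigroup
  let I : Y →L[𝕜] Y := LinearMap.mkContinuous
    { toFun := fun x => ∫ s in (0 : ℝ)..t₀, R s x
      map_add' := fun x x' => by
        simp only [map_add]
        exact intervalIntegral.integral_add (hR.intervalIntegrable x le_rfl ht₀.le)
          (hR.intervalIntegrable x' le_rfl ht₀.le)
      map_smul' := fun a x => by
        simp only [map_smul, RingHom.id_apply]
        exact intervalIntegral.integral_smul _ _ }
    (M * t₀) fun x => by
      have := intervalIntegral.norm_integral_le_of_norm_le_const (a := 0) (b := t₀)
        (f := fun s => R s x) (C := M * ‖x‖) fun s hs => by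
          rw [uIoc_of_le ht₀.le] at hs
          exact (ContinuousLinearMap.le_opNorm _ _).trans (by gcongr; exact hMb s ⟨hs.1.le, hs.2⟩)
      rw [sub_zero, abs_of_pos ht₀] at this
      exact this.trans_eq (by ring)
  let K : Y →L[𝕜] genGraph T₀ :=
    (I.prod (R t₀ - ContinuousLinearMap.id 𝕜 Y + l • I)).codRestrict (genGraph T₀) hmem
  have hC : ‖C.comp K‖ ≤ κ := by
    refine opNorm_le_of_denseRange (e := (LinearMap.fst 𝕜 Y Y).comp (genGraph T₀).subtype)
      hT₀.denseRange_fst hκ0 fun v => ?_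
    have : CompleteSpace (genGraph T₀) := hT₀.isClosed_genGraph.completeSpace_coe
    have hΓ : ∀ v ∈ genGraph T₀, ∀ t, 0 ≤ t → (R t v.1, R t v.2) ∈ genGraph T₀ := by
      intro v hv t ht
      have := (genGraph T₀).smul_mem ((Real.exp (-l * t) : ℝ) : 𝕜) (hT₀.apply_mem_genGraph hv ht)
      rwa [← RCLike.real_smul_eq_coe_smul] at this
    have hcont := continuous_graphOrbit hR hΓ v
    have hKv : K (v : Y × Y).1 = ∫ s in (0 : ℝ)..t₀, graphOrbit hΓ v s := by
      have e1 : (K (v : Y × Y).1 : Y × Y).1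
          = ((∫ s in (0 : ℝ)..t₀, graphOrbit hΓ v s : genGraph T₀) : Y × Y).1 := by
        have := (((ContinuousLinearMap.fst 𝕜 Y Y).comp
          (genGraph T₀).subtypeL).restrictScalars ℝ).intervalIntegral_comp_comm
          (hcont.intervalIntegrable (μ := volume) 0 t₀)
        refine Eq.trans ?_ this
        refine intervalIntegral.integral_congr fun s hs => ?_
        rw [uIcc_of_le ht₀.le] at hs
        simp only [graphOrbit_of_nonneg hΓ v hs.1]
        rfl
      refine Subtype.ext (Prod.ext e1 (genGraph_unique (T := T₀) (K _).2 ?_))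
      have e2 := (∫ s in (0 : ℝ)..t₀, graphOrbit hΓ v s : genGraph T₀).2
      rwa [← Prod.mk.eta (p := ((∫ s in (0 : ℝ)..t₀, graphOrbit hΓ v s : genGraph T₀) : Y × Y)),
        ← e1] at e2
    have hCK : C (K (v : Y × Y).1) = ∫ s in (0 : ℝ)..t₀, output hΓ C v s := by
      rw [hKv]
      exact ((C.restrictScalars ℝ).intervalIntegral_comp_comm
        (hcont.intervalIntegrable (μ := volume) 0 t₀)).symm
    change ‖C (K (v : Y × Y).1)‖ ≤ κ * ‖(v : Y × Y).1‖
    rw [hCK]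
    refine le_trans ?_ (hb v)
    refine intervalIntegral.norm_integral_le_of_norm_le ht₀.le (Eventually.of_forall fun s hs => ?_)
      ((continuous_output hT₀ _ C v).norm.intervalIntegrable _ _)
    have e2 : graphOrbit hΓ v s = ((Real.exp (-l * s) : ℝ) : 𝕜) •
        graphOrbit (fun _ hv _ => hT₀.apply_mem_genGraph hv) v s := by
      rw [graphOrbit_of_nonneg _ _ hs.1.le, graphOrbit_of_nonneg _ _ hs.1.le]
      refine Subtype.ext ?_
      simp only [Submodule.coe_smul, Prod.smul_mk, ← RCLike.real_smul_eq_coe_smul]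
      rfl
    rw [output_apply, output_apply, e2, map_smul, norm_smul, RCLike.norm_ofReal,
      abs_of_pos (Real.exp_pos _)]
    refine mul_le_of_le_one_left (norm_nonneg _) (Real.exp_le_one_iff.2 ?_)
    nlinarith [hs.1]
  have hW : ‖R t₀ + J.comp (C.comp K)‖ < 1 := by
    refine (norm_add_le _ _).trans_lt (lt_of_le_of_lt ?_ hsmall)
    gcongr
    exact (ContinuousLinearMap.opNorm_comp_le _ _).trans
      ((mul_le_of_le_one_left (norm_nonneg _) hJ).trans hC)
  obtain ⟨u, hu⟩ := isUnit_one_sub_of_norm_lt_one hW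
  have hx : (1 - (R t₀ + J.comp (C.comp K))) ((↑u⁻¹ : Y →L[𝕜] Y) y) = y := by
    rw [← hu]
    exact DFunLike.congr_fun u.mul_inv y
  set x := (↑u⁻¹ : Y →L[𝕜] Y) y
  refine ⟨_, mem_perturbedGraph.2 ⟨K x, rfl⟩, ?_⟩
  refine Eq.trans ?_ hx
  change l • I x - ((R t₀ x - x + l • I x) + J (C (K x))) = x - (R t₀ x + J (C (K x)))
  abel

/-- The Miyadera–Voigt perturbation theorem for the perturbation `J C` of the generator `G` of `T₀`,
where `C` is an observation which is small over short times. If `t ↦ T₀ t J` is norm continuous on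
`(0, ∞)`, then the difference of the perturbed and the unperturbed semigroup is norm continuous on
`[0, ∞)`. -/
theorem exists_perturbed_semigroup (hT₀ : IsC0Semigroup T₀) (C : genGraph T₀ →L[𝕜] X)
    {J : X →L[𝕜] Y} (hJ : ‖J‖ ≤ 1) {q : ℝ → ℝ≥0} (hq : Tendsto q (𝓝[>] 0) (𝓝 0))
    (hC : ∀ v t, 0 < t → ∫ s in (0 : ℝ)..t,
      ‖output (fun _ hv _ => hT₀.apply_mem_genGraph hv) C v s‖ ≤ q t * ‖(v : Y × Y).1‖) :
    ∃ T : ℝ → Y →L[𝕜] Y, IsC0Semigroup T ∧ genGraph T = perturbedGraph C J ∧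
      (ContinuousOn (fun t => (T₀ t).comp J) (Ioi 0) →
        ContinuousOn (fun t => T t - T₀ t) (Ici 0)) := by
  obtain ⟨t₀, hqt, ht₀⟩ : ∃ t, q t < 1 ∧ 0 < t :=
    ((hq.eventually_lt_const one_pos).and self_mem_nhdsWithin).exists
  obtain ⟨κ, hκq⟩ : ∃ κ : ℝ, κ = q t₀ := ⟨_, rfl⟩
  have hκ0 : 0 ≤ κ := by rw [hκq]; exact (q t₀).2
  have hκ : κ < 1 := by rw [hκq]; exact_mod_cast hqt
  obtain ⟨M, ω₀, hM, hω₀, hexp⟩ := hT₀.exists_exp_bound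
  -- for large `l` the rescaled semigroup is as contractive as desired at time `t₀`
  have hlarge : ∀ᶠ l in atTop, ‖Real.exp (-l * t₀) • T₀ t₀‖ ≤ (1 - κ) / 2 := by
    have h1 : Tendsto (fun l : ℝ => Real.exp (-l * t₀) * ‖T₀ t₀‖) atTop (𝓝 0) := by
      have h2 : Tendsto (fun l : ℝ => -l * t₀) atTop atBot :=
        tendsto_neg_atTop_atBot.atBot_mul_const ht₀
      simpa using (Real.tendsto_exp_atBot.comp h2).mul_const ‖T₀ t₀‖
    filter_upwards [h1.eventually_lt_const (show 0 < (1 - κ) / 2 by linarith)] with l hl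
    rw [norm_smul, Real.norm_of_nonneg (Real.exp_nonneg _)]
    exact hl.le
  obtain ⟨ω, hω, hωs⟩ := (hlarge.and (eventually_ge_atTop ω₀)).exists
  set R : ℝ → Y →L[𝕜] Y := fun t => Real.exp (-ω * t) • T₀ t with hRdef
  have hR : IsC0Semigroup R := hT₀.exp_smul (-ω)
  have hRM : ∀ t, 0 ≤ t → ‖R t‖ ≤ M := by
    intro t ht
    rw [hRdef, norm_smul, Real.norm_of_nonneg (Real.exp_nonneg _)]
    calc Real.exp (-ω * t) * ‖T₀ t‖ ≤ Real.exp (-ω * t) * (M * Real.exp (ω₀ * t)) := by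
          gcongr
          exact hexp t ht
      _ = M * Real.exp (-ω * t + ω₀ * t) := by rw [Real.exp_add]; ring
      _ ≤ M * 1 := by
          gcongr
          rw [Real.exp_le_one_iff]
          nlinarith
      _ = M := mul_one M
  have hΓ : ∀ v ∈ genGraph T₀, ∀ t, 0 ≤ t → (R t v.1, R t v.2) ∈ genGraph T₀ := by
    intro v hv t ht
    have := (genGraph T₀).smul_mem ((Real.exp (-ω * t) : ℝ) : 𝕜) (hT₀.apply_mem_genGraph hv ht)
    rwa [← RCLike.real_smul_eq_coe_smul] at this
  have hscale : ∀ v s, 0 ≤ s → output hΓ C v s = ((Real.exp (-ω * s) : ℝ) : 𝕜) •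
      output (fun _ hv _ => hT₀.apply_mem_genGraph hv) C v s := by
    intro v s hs
    rw [output_apply, output_apply, ← map_smul, graphOrbit_of_nonneg _ _ hs,
      graphOrbit_of_nonneg _ _ hs]
    congr 1
    refine Subtype.ext ?_
    simp only [Submodule.coe_smul, Prod.smul_mk, ← RCLike.real_smul_eq_coe_smul]
    rfl
  have hout : ∀ v t, 0 < t → ∫ s in (0 : ℝ)..t, ‖output hΓ C v s‖ ≤ q t * ‖(v : Y × Y).1‖ := by
    intro v t ht
    refine le_trans ?_ (hC v t ht)
    refine intervalIntegral.integral_mono_on ht.le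
      ((continuous_output hR hΓ C v).norm.intervalIntegrable _ _)
      ((continuous_output hT₀ _ C v).norm.intervalIntegrable _ _) fun s hs => ?_
    rw [hscale v s hs.1, norm_smul, RCLike.norm_ofReal, abs_of_pos (Real.exp_pos _)]
    refine mul_le_of_le_one_left (norm_nonneg _) (Real.exp_le_one_iff.2 ?_)
    nlinarith [hs.1]
  -- the rescaled semigroup is observed with a constant `< 1` on all of `[0, ∞)`, so that the
  -- Volterra equation is solved on `[0, ∞)` at once
  have hobs := isObservation_output hR hΓ C hT₀.denseRange_fst ht₀ hκ0 hκ
    (fun v => hκq ▸ hout v t₀ ht₀) hω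
  have hκ1 : (1 + κ) / 2 < 1 := by linarith
  obtain ⟨F, hF, hFN⟩ := exists_volterra_fixedPoint hobs hκ1 hJ (orbitMap hR hRM)
  have hFev : ∀ v t, 0 ≤ t → F (v : genGraph T₀).1.1 t = R t v.1.1
      + ∫ s in (0 : ℝ)..t, F (J (output hΓ C v s)) (t - s) := by
    intro v t ht
    conv_lhs => rw [hF]
    have := volterra_apply hobs (F.comp J) v ht
    change orbitMap hR hRM v.1.1 t + volterra hobs (F.comp J) v.1.1 t = _
    rw [orbitMap_apply hR hRM _ ht]
    exact congrArg _ this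
  have hS : IsC0Semigroup (evalAt F) := isC0Semigroup_of_volterra hobs hκ1 hR hJ hFev
  have hT : IsC0Semigroup fun t => Real.exp (ω * t) • evalAt F t := hS.exp_smul ω
  have hexpR : ∀ t, Real.exp (ω * t) • R t = T₀ t := fun t => by
    rw [hRdef, smul_smul, ← Real.exp_add, neg_mul, add_neg_cancel, Real.exp_zero, one_smul]
  refine ⟨_, hT, ?_, fun hcont => ?_⟩
  · refine hT.genGraph_eq_of_surjective (perturbedGraph_le_of_duhamel hT₀ hT fun v t ht => ?_)
      fun Λ => ?_
    · have e1 : (Real.exp (ω * t) • evalAt F t) v.1.1 = Real.exp (ω * t) • F v.1.1 t := rfl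
      rw [e1, hFev v t ht, smul_add, ← intervalIntegral.integral_smul, ← hexpR t]
      congr 1
      refine intervalIntegral.integral_congr fun s hs => ?_
      rw [uIcc_of_le ht] at hs
      have e2 : ∀ x, F (((Real.exp (-ω * s) : ℝ) : 𝕜) • x) (t - s)
          = Real.exp (-ω * s) • F x (t - s) := fun x => by
        rw [map_smul, RCLike.real_smul_eq_coe_smul (K := 𝕜)]; rfl
      have e3 : F (J (output hΓ C v s)) (t - s) = Real.exp (-ω * s) •
          F (J (output (fun _ hv _ => hT₀.apply_mem_genGraph hv) C v s)) (t - s) := by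
        rw [hscale v s hs.1, map_smul J, e2]
      change Real.exp (ω * t) • F (J (output hΓ C v s)) (t - s) = Real.exp (ω * (t - s)) •
        F (J (output (fun _ hv _ => hT₀.apply_mem_genGraph hv) C v s)) (t - s)
      rw [e3, smul_smul, ← Real.exp_add]
      congr 2
      ring
    · obtain ⟨l, hl, hlΛ⟩ := (hlarge.and (eventually_ge_atTop (max Λ 0))).exists
      refine ⟨l, (le_max_left _ _).trans hlΛ, perturbedGraph_surjective hT₀ hJ ht₀ hκ0
        ((le_max_right _ _).trans hlΛ) (fun v => hκq ▸ hC v t₀ ht₀) (by linarith)⟩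
  · have hsmall : ∀ ε > 0, ∃ δ > 0, ∀ v, ∫ s in (0 : ℝ)..δ, ‖output hΓ C v s‖
        ≤ ε * ‖((LinearMap.fst 𝕜 Y Y).comp (genGraph T₀).subtype) v‖ := by
      intro ε hε
      have hq' : Tendsto (fun t => (q t : ℝ)) (𝓝[>] 0) (𝓝 0) := by
        have := NNReal.tendsto_coe.2 hq
        rwa [NNReal.coe_zero] at this
      obtain ⟨δ, hδ, hδ0⟩ := ((hq'.eventually_lt_const hε).and self_mem_nhdsWithin).exists
      exact ⟨δ, hδ0, fun v => (hout v δ hδ0).trans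
        (mul_le_mul_of_nonneg_right hδ.le (norm_nonneg _))⟩
    have hsc : ContinuousOn (fun t => Real.exp (-ω * t) • (T₀ t).comp J) (Ioi 0) :=
      (by fun_prop : Continuous fun t : ℝ => Real.exp (-ω * t)).continuousOn.smul hcont
    have hFJ := hFN _ (isClosed_setOf_continuousOn J) (by
        refine hsc.congr fun t ht => ?_
        ext x
        exact orbitMap_apply hR hRM _ (le_of_lt ht))
      (fun G hG => by
        have h1 := (continuousOn_volterra hobs hRM hsmall hG).mono Ioi_subset_Ici_self
        have h2 : ContinuousOn (fun t => (evalAt (volterra hobs (G.comp J)) t).comp J) (Ioi 0) :=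
          h1.clm_comp continuousOn_const
        refine (hsc.add h2).congr fun t ht => ?_
        ext x
        change orbitMap hR hRM (J x) t + volterra hobs (G.comp J) (J x) t = _
        rw [orbitMap_apply hR hRM _ (le_of_lt ht)]
        rfl)
    have h1 := continuousOn_volterra hobs hRM hsmall hFJ
    have h2 : ContinuousOn (fun t => Real.exp (ω * t) • evalAt (volterra hobs (F.comp J)) t)
        (Ici 0) :=
      (by fun_prop : Continuous fun t : ℝ => Real.exp (ω * t)).continuousOn.smul h1
    refine h2.congr fun t ht => ?_
    have e : evalAt F t = R t + evalAt (volterra hobs (F.comp J)) t := by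
      ext y
      change F y t = R t y + volterra hobs (F.comp J) y t
      rw [← orbitMap_apply hR hRM y ht]
      conv_lhs => rw [hF]
      rfl
    simp only
    rw [e, smul_add, hexpR, add_sub_cancel_left]

end MiyaderaVoigt

end DelayEquation

/-! ### Translations and the segments of an orbit in `L^p` -/

namespace DelayEquation

lemma memLp_indicator_of_bound {Z : Type*} [NormedAddCommGroup Z] {p : ℝ≥0∞} {s : Set ℝ}
    (hs : MeasurableSet s) (hs' : volume s ≠ ∞) {F : ℝ → Z}
    (hF : AEStronglyMeasurable F (volume.restrict s)) (M : ℝ) (hM : ∀ r ∈ s, ‖F r‖ ≤ M) :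
    MemLp (s.indicator F) p volume := by
  have : IsFiniteMeasure (volume.restrict s) := ⟨by simpa using hs'.lt_top⟩
  rw [memLp_indicator_iff_restrict hs]
  refine MemLp.of_bound hF M ?_
  filter_upwards [ae_restrict_mem hs] with r hr using hM r hr

/-- Translation is continuous in `L^p(ℝ)` for `p < ∞`. -/
lemma tendsto_eLpNorm_translate {Z : Type*} [NormedAddCommGroup Z] {p : ℝ≥0∞} [Fact (1 ≤ p)]
    (hp : p ≠ ∞) {F : ℝ → Z} (hF : MemLp F p volume) (t₀ : ℝ) :
    Tendsto (fun t => eLpNorm (fun τ => F (t + τ) - F (t₀ + τ)) p volume) (𝓝 t₀) (𝓝 0) := by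
  let g : ℝ → C(ℝ, ℝ) := fun t => ⟨fun τ => t + τ, by fun_prop⟩
  have hg : Continuous g :=
    ContinuousMap.continuous_of_continuous_uncurry _ (by
      simp only [g, Function.uncurry_def, ContinuousMap.coe_mk]; fun_prop)
  have hm : ∀ t, MeasurePreserving (g t) volume volume := fun t => measurePreserving_add_left _ t
  have h := (tendsto_const_nhds (x := hF.toLp F)).compMeasurePreservingLp (hg.tendsto t₀) hm
    (hm t₀) hp
  have h2 := Lp.tendsto_Lp_iff_tendsto_eLpNorm' _ _ |>.1 h
  refine h2.congr fun t => eLpNorm_congr_ae ?_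
  filter_upwards [Lp.coeFn_compMeasurePreserving (hF.toLp F) (hm t),
    Lp.coeFn_compMeasurePreserving (hF.toLp F) (hm t₀),
    (hm t).quasiMeasurePreserving.ae_eq_comp hF.coeFn_toLp,
    (hm t₀).quasiMeasurePreserving.ae_eq_comp hF.coeFn_toLp] with τ h1 h2 h3 h4
  rw [Pi.sub_apply, h1, h2, h3, h4]
  rfl

instance : IsProbabilityMeasure delayMeasure := ⟨by simp⟩

section Segments

variable {𝕜 : Type*} [RCLike 𝕜] {X : Type*} [NormedAddCommGroup X] [NormedSpace 𝕜 X]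
  {p : ℝ≥0∞}

lemma orbitSegment_add (S : ℝ → X →L[𝕜] X) (t : ℝ) (x y : X) :
    orbitSegment S t (x + y) = orbitSegment S t x + orbitSegment S t y := by
  funext τ
  simp only [orbitSegment, Pi.add_apply]
  split_ifs <;> simp

lemma orbitSegment_smul (S : ℝ → X →L[𝕜] X) (t : ℝ) (a : 𝕜) (x : X) :
    orbitSegment S t (a • x) = a • orbitSegment S t x := by
  funext τ
  simp only [orbitSegment, Pi.smul_apply]
  split_ifs <;> simp

lemma norm_orbitSegment_le {S : ℝ → X →L[𝕜] X} {t M : ℝ} (hM0 : 0 ≤ M)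
    (hM : ∀ s ∈ Icc 0 t, ‖S s‖ ≤ M) (x : X) {τ : ℝ} (hτ : τ ≤ 0) :
    ‖orbitSegment S t x τ‖ ≤ M * ‖x‖ := by
  unfold orbitSegment
  split_ifs with h
  · exact (ContinuousLinearMap.le_opNorm _ _).trans
      (by gcongr; exact hM _ ⟨by linarith, by linarith⟩)
  · rw [norm_zero]; positivity

lemma aestronglyMeasurable_orbitSegment {S : ℝ → X →L[𝕜] X} (hS : IsC0Semigroup S) (t : ℝ)
    (x : X) : AEStronglyMeasurable (orbitSegment S t x) delayMeasure := by
  have hind : orbitSegment S t x = (Ioi (-t)).indicator (fun τ => S (t + τ) x) := by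
    ext τ; simp [orbitSegment, indicator]
  have hc : ContinuousOn (fun τ => S (t + τ) x) (Icc (-t) 0) :=
    (hS.continuousOn_orbit x).comp (by fun_prop) fun τ hτ => by
      simp only [mem_Ici]; linarith [hτ.1]
  rw [hind, aestronglyMeasurable_indicator_iff measurableSet_Ioi,
    Measure.restrict_restrict measurableSet_Ioi]
  refine (hc.aestronglyMeasurable measurableSet_Icc).mono_set ?_
  exact fun τ hτ => ⟨le_of_lt hτ.1, hτ.2.2⟩

lemma memLp_orbitSegment [CompleteSpace X] {S : ℝ → X →L[𝕜] X} (hS : IsC0Semigroup S) (t : ℝ)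
    (x : X) : MemLp (orbitSegment S t x) p delayMeasure := by
  obtain ⟨M, hM, hb⟩ := hS.exists_bound t
  refine MemLp.of_bound (aestronglyMeasurable_orbitSegment hS t x) (M * ‖x‖) ?_
  filter_upwards [ae_mem_Icc] with τ hτ
  exact norm_orbitSegment_le (by linarith) hb x hτ.2

lemma leftShift_eq_indicator (t : ℝ) (f : ℝ → X) :
    leftShift t f = (Iic (-t)).indicator (fun τ => f (t + τ)) := by
  ext τ
  simp only [leftShift, indicator, mem_Iic]
  congr 1
  exact propext ⟨fun h => by linarith, fun h => by linarith⟩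

lemma measurePreserving_shift_restrict (t : ℝ) :
    MeasurePreserving (fun τ : ℝ => t + τ)
      (volume.restrict ((fun τ : ℝ => t + τ) ⁻¹' Icc (-1 : ℝ) 0)) delayMeasure :=
  (measurePreserving_add_left volume t).restrict_preimage measurableSet_Icc

lemma restrict_Iic_delayMeasure_le {t : ℝ} (ht : 0 ≤ t) :
    delayMeasure.restrict (Iic (-t))
      ≤ volume.restrict ((fun τ : ℝ => t + τ) ⁻¹' Icc (-1 : ℝ) 0) := by
  rw [Measure.restrict_restrict measurableSet_Iic]
  refine Measure.restrict_mono (fun τ hτ => ?_) le_rfl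
  have h1 : τ ≤ -t := hτ.1
  have h2 := hτ.2.1
  exact ⟨by linarith, by linarith⟩

lemma memLp_leftShift {t : ℝ} (ht : 0 ≤ t) {f : ℝ → X} (hf : MemLp f p delayMeasure) :
    MemLp (leftShift t f) p delayMeasure := by
  rw [leftShift_eq_indicator, memLp_indicator_iff_restrict measurableSet_Iic]
  exact (hf.comp_measurePreserving (measurePreserving_shift_restrict t)).mono_measure
    (restrict_Iic_delayMeasure_le ht)

lemma eLpNorm_leftShift_le {t : ℝ} (ht : 0 ≤ t) {f : ℝ → X} (hf : MemLp f p delayMeasure) :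
    eLpNorm (leftShift t f) p delayMeasure ≤ eLpNorm f p delayMeasure := by
  rw [leftShift_eq_indicator, eLpNorm_indicator_eq_eLpNorm_restrict measurableSet_Iic,
    ← eLpNorm_comp_measurePreserving hf.aestronglyMeasurable (measurePreserving_shift_restrict t)]
  exact eLpNorm_mono_measure _ (restrict_Iic_delayMeasure_le ht)

lemma leftShift_congr_ae {t : ℝ} (ht : 0 ≤ t) {f g : ℝ → X} (h : f =ᵐ[delayMeasure] g) :
    leftShift t f =ᵐ[delayMeasure] leftShift t g := by
  have h1 := (measurePreserving_add_left volume t).quasiMeasurePreserving.ae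
    ((ae_restrict_iff' measurableSet_Icc).1 h)
  filter_upwards [ae_restrict_of_ae h1, ae_mem_Icc] with τ h2 hτ
  unfold leftShift
  split_ifs with h3
  · exact h2 ⟨by linarith [hτ.1], h3⟩
  · rfl

/-- The operator `x ↦ S_t x` from `X` to `L^p([-1, 0], X)`; the times `t < 0` are treated as
`t = 0`. -/
noncomputable def segmentOp [CompleteSpace X] (p : ℝ≥0∞) [Fact (1 ≤ p)] {S : ℝ → X →L[𝕜] X}
    (hS : IsC0Semigroup S) (t : ℝ) : X →L[𝕜] Lp₀ X p :=
  LinearMap.mkContinuousOfExistsBound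
    { toFun := fun x => (memLp_orbitSegment hS (max t 0) x).toLp _
      map_add' := fun x y => by
        rw [← MemLp.toLp_add]
        exact MemLp.toLp_congr _ _ (Eventually.of_forall (congrFun (orbitSegment_add S _ x y)))
      map_smul' := fun a x => by
        rw [RingHom.id_apply, ← MemLp.toLp_const_smul]
        exact MemLp.toLp_congr _ _ (Eventually.of_forall (congrFun (orbitSegment_smul S _ a x))) }
    (by
      obtain ⟨M, hM, hb⟩ := hS.exists_bound (max t 0)
      refine ⟨M, fun x => ?_⟩
      change ‖(memLp_orbitSegment hS (max t 0) x).toLp _‖ ≤ M * ‖x‖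
      have h := Lp.norm_le_of_ae_bound (p := p) (μ := delayMeasure)
        (f := (memLp_orbitSegment hS (max t 0) x).toLp _) (C := M * ‖x‖) (by positivity) (by
          filter_upwards [(memLp_orbitSegment (p := p) hS (max t 0) x).coeFn_toLp, ae_mem_Icc]
            with τ h1 hτ
          rw [h1]
          exact norm_orbitSegment_le (by linarith) hb x hτ.2)
      simpa [measureUnivNNReal] using h)

/-- The nilpotent shift `T₀(t)` on `L^p([-1, 0], X)`; the times `t < 0` are treated as `t = 0`. -/
noncomputable def shiftOp (𝕜 : Type*) [RCLike 𝕜] (X : Type*) [NormedAddCommGroup X]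
    [NormedSpace 𝕜 X] (p : ℝ≥0∞) [Fact (1 ≤ p)] (t : ℝ) : Lp₀ X p →L[𝕜] Lp₀ X p :=
  LinearMap.mkContinuous
    { toFun := fun f => (memLp_leftShift (le_max_right t 0) (Lp.memLp f)).toLp _
      map_add' := fun f g => by
        rw [← MemLp.toLp_add]
        refine MemLp.toLp_congr _ _ ((leftShift_congr_ae (le_max_right t 0)
          (Lp.coeFn_add f g)).trans (Eventually.of_forall fun τ => ?_))
        simp only [leftShift, Pi.add_apply]
        split_ifs <;> simp
      map_smul' := fun a f => by
        rw [RingHom.id_apply, ← MemLp.toLp_const_smul]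
        refine MemLp.toLp_congr _ _ ((leftShift_congr_ae (le_max_right t 0)
          (Lp.coeFn_smul a f)).trans (Eventually.of_forall fun τ => ?_))
        simp only [leftShift, Pi.smul_apply]
        split_ifs <;> simp }
    1 fun f => by
      rw [one_mul]
      change ‖(memLp_leftShift (le_max_right t 0) (Lp.memLp f)).toLp _‖ ≤ ‖f‖
      rw [Lp.norm_toLp, Lp.norm_def]
      exact ENNReal.toReal_mono (Lp.eLpNorm_ne_top f)
        (eLpNorm_leftShift_le (le_max_right t 0) (Lp.memLp f))

variable [Fact (1 ≤ p)]

lemma coeFn_segmentOp [CompleteSpace X] {S : ℝ → X →L[𝕜] X} (hS : IsC0Semigroup S) {t : ℝ}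
    (ht : 0 ≤ t) (x : X) : segmentOp p hS t x =ᵐ[delayMeasure] orbitSegment S t x := by
  have h : segmentOp p hS t x =ᵐ[delayMeasure] orbitSegment S (max t 0) x :=
    (memLp_orbitSegment hS (max t 0) x).coeFn_toLp
  rwa [max_eq_left ht] at h

lemma coeFn_shiftOp {t : ℝ} (ht : 0 ≤ t) (f : Lp₀ X p) :
    shiftOp 𝕜 X p t f =ᵐ[delayMeasure] leftShift t f := by
  have h : shiftOp 𝕜 X p t f =ᵐ[delayMeasure] leftShift (max t 0) f :=
    (memLp_leftShift (le_max_right t 0) (Lp.memLp f)).coeFn_toLp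
  rwa [max_eq_left ht] at h

lemma shiftOp_eq_zero {t : ℝ} (ht : 1 ≤ t) : shiftOp 𝕜 X p t = 0 := by
  ext1 f
  refine Lp.ext ((coeFn_shiftOp (zero_le_one.trans ht) f).trans ?_)
  have hne : ∀ᵐ τ ∂delayMeasure, τ ≠ -1 := ae_restrict_of_ae (Measure.ae_ne volume (-1 : ℝ))
  filter_upwards [Lp.coeFn_zero X p delayMeasure, ae_mem_Icc, hne] with τ h0 hτ h1
  rw [zero_apply, h0, Pi.zero_apply, leftShift, if_neg]
  have := lt_of_le_of_ne hτ.1 h1.symm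
  linarith

lemma continuousOn_shiftOp (hp : p ≠ ∞) (f : Lp₀ X p) :
    ContinuousOn (fun t => shiftOp 𝕜 X p t f) (Ici 0) := by
  intro t₀ ht₀
  have hF : MemLp ((Icc (-1 : ℝ) 0).indicator f) p volume :=
    (memLp_indicator_iff_restrict measurableSet_Icc).2 (Lp.memLp f)
  have h := (tendsto_eLpNorm_translate hp hF t₀).mono_left (nhdsWithin_le_nhds (s := Ici 0))
  refine (Lp.tendsto_Lp_iff_tendsto_eLpNorm' _ _).2 (tendsto_of_tendsto_of_tendsto_of_le_of_le'
    tendsto_const_nhds h (Eventually.of_forall fun _ => bot_le) ?_)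
  filter_upwards [self_mem_nhdsWithin] with t ht
  refine le_trans (eLpNorm_mono_ae ?_) (eLpNorm_mono_measure _ Measure.restrict_le_self)
  have hind : ∀ r, 0 ≤ r → ∀ τ ∈ Icc (-1 : ℝ) 0,
      leftShift r f τ = (Icc (-1 : ℝ) 0).indicator f (r + τ) := by
    intro r hr τ hτ
    by_cases h : r + τ ≤ 0
    · rw [leftShift, if_pos h,
        indicator_of_mem (show r + τ ∈ Icc (-1 : ℝ) 0 from ⟨by linarith [hτ.1], h⟩)]
    · rw [leftShift, if_neg h, indicator_of_notMem fun h' => h h'.2]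
  filter_upwards [coeFn_shiftOp (𝕜 := 𝕜) ht f, coeFn_shiftOp (𝕜 := 𝕜) ht₀ f, ae_mem_Icc]
    with τ h1 h2 hτ
  rw [Pi.sub_apply, h1, h2, hind t ht τ hτ, hind t₀ ht₀ τ hτ]

/-- If `S` is immediately norm continuous, then `t ↦ S_t` is norm continuous, because translation
is continuous on the `L^p` functions with values in the operators. -/
lemma continuousOn_segmentOp [CompleteSpace X] (hp : p ≠ ∞) {S : ℝ → X →L[𝕜] X}
    (hS : IsC0Semigroup S) (hn : ImmediatelyNormContinuous S) :
    ContinuousOn (segmentOp p hS) (Ici 0) := by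
  intro t₀ ht₀
  obtain ⟨N, hN₀⟩ : ∃ N, t₀ < N := exists_gt t₀
  obtain ⟨F, hFdef⟩ : ∃ F : ℝ → X →L[𝕜] X, F = (Ioc 0 N).indicator S := ⟨_, rfl⟩
  obtain ⟨M, hM, hb⟩ := hS.exists_bound N
  have hF : MemLp F p volume := by
    have hn' : ContinuousOn S (Ioc 0 N) :=
      (show ContinuousOn S (Ioi 0) from hn).mono Ioc_subset_Ioi_self
    rw [hFdef]
    refine memLp_indicator_of_bound measurableSet_Ioc measure_Ioc_lt_top.ne
      (hn'.aestronglyMeasurable measurableSet_Ioc) M ?_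
    exact fun s hs => hb s ⟨hs.1.le, hs.2⟩
  have h := (tendsto_eLpNorm_translate hp hF t₀).mono_left (nhdsWithin_le_nhds (s := Ici 0))
  have h' := (ENNReal.tendsto_toReal ENNReal.zero_ne_top).comp h
  rw [ContinuousWithinAt, tendsto_iff_norm_sub_tendsto_zero]
  refine squeeze_zero' (Eventually.of_forall fun _ => norm_nonneg _) ?_ h'
  have hN : ∀ᶠ t in 𝓝[Ici 0] t₀, t ≤ N :=
    mem_nhdsWithin_of_mem_nhds (Iic_mem_nhds hN₀)
  filter_upwards [self_mem_nhdsWithin, hN] with t ht htN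
  refine ContinuousLinearMap.opNorm_le_bound _ ENNReal.toReal_nonneg fun x => ?_
  have hind : ∀ r, r ≤ N → ∀ τ ≤ 0, orbitSegment S r x τ = F (r + τ) x := by
    intro r hr τ hτ
    by_cases h : -r < τ
    · rw [orbitSegment, if_pos h, hFdef,
        indicator_of_mem (show r + τ ∈ Ioc 0 N from ⟨by linarith, by linarith⟩)]
    · rw [orbitSegment, if_neg h, hFdef, indicator_of_notMem fun h' => h (by linarith [h'.1])]
      rfl
  have hfin : eLpNorm (fun τ => F (t + τ) - F (t₀ + τ)) p volume ≠ ∞ :=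
    ((hF.comp_measurePreserving (measurePreserving_add_left volume t)).sub
      (hF.comp_measurePreserving (measurePreserving_add_left volume t₀))).eLpNorm_ne_top
  have hle : eLpNorm (segmentOp p hS t x - segmentOp p hS t₀ x : Lp₀ X p) p delayMeasure
      ≤ ENNReal.ofReal ‖x‖ * eLpNorm (fun τ => F (t + τ) - F (t₀ + τ)) p volume := by
    refine le_trans (eLpNorm_le_mul_eLpNorm_of_ae_le_mul (c := ‖x‖)
      (g := fun τ => F (t + τ) - F (t₀ + τ)) ?_ p) ?_
    · filter_upwards [Lp.coeFn_sub (segmentOp p hS t x) (segmentOp p hS t₀ x),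
        coeFn_segmentOp (p := p) hS ht x, coeFn_segmentOp (p := p) hS ht₀ x, ae_mem_Icc]
        with τ h1 h2 h3 hτ
      rw [h1, Pi.sub_apply, h2, h3, hind t htN τ hτ.2, hind t₀ (by linarith) τ hτ.2,
        ← sub_apply, mul_comm]
      exact ContinuousLinearMap.le_opNorm _ _
    · exact mul_le_mul' le_rfl (eLpNorm_mono_measure _ Measure.restrict_le_self)
  calc ‖(segmentOp p hS t - segmentOp p hS t₀) x‖
      = (eLpNorm (segmentOp p hS t x - segmentOp p hS t₀ x : Lp₀ X p) p delayMeasure).toReal := by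
        rw [sub_apply, Lp.norm_def]
    _ ≤ (ENNReal.ofReal ‖x‖ * eLpNorm (fun τ => F (t + τ) - F (t₀ + τ)) p volume).toReal :=
        ENNReal.toReal_mono (ENNReal.mul_ne_top ENNReal.ofReal_ne_top hfin) hle
    _ = _ := by
        rw [ENNReal.toReal_mul, ENNReal.toReal_ofReal (norm_nonneg _), mul_comm]
        rfl

end Segments

end DelayEquation

/-! ### The unperturbed delay semigroup -/

namespace DelayEquation

section DelaySemigroup

variable {𝕜 : Type*} [RCLike 𝕜] {X : Type*} [NormedAddCommGroup X] [NormedSpace 𝕜 X]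
  {p : ℝ≥0∞} [Fact (1 ≤ p)] {S : ℝ → X →L[𝕜] X}

/-- The history `f` on `(-∞, 0]`, continued by the orbit of `x` under `S` on `(0, ∞)`. -/
noncomputable def trajectory (S : ℝ → X →L[𝕜] X) (x : X) (f : ℝ → X) (r : ℝ) : X :=
  if r ≤ 0 then f r else S r x

lemma orbitSegment_add_leftShift (S : ℝ → X →L[𝕜] X) (x : X) (f : ℝ → X) (t τ : ℝ) :
    orbitSegment S t x τ + leftShift t f τ = trajectory S x f (t + τ) := by
  by_cases h : t + τ ≤ 0
  · simp [orbitSegment, leftShift, trajectory, h, show ¬ (-t < τ) by linarith]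
  · simp [orbitSegment, leftShift, trajectory, h, show -t < τ by linarith]

lemma intervalIntegrable_trajectory (hS : IsC0Semigroup S) (x : X) (f : Lp₀ X p) {a b : ℝ}
    (ha : -1 ≤ a) (hb : -1 ≤ b) : IntervalIntegrable (trajectory S x f) volume a b := by
  have h0 : ∀ r, -1 ≤ r → IntervalIntegrable (trajectory S x f) volume 0 r := by
    intro r hr
    rcases le_total r 0 with h | h
    · refine (intervalIntegrable_coe f ⟨hr, h⟩).congr fun s hs => ?_
      rw [uIoc_of_ge h] at hs
      rw [trajectory, if_pos hs.2]
    · refine (hS.intervalIntegrable x le_rfl h).congr fun s hs => ?_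
      rw [uIoc_of_le h] at hs
      rw [trajectory, if_neg (not_le.2 hs.1)]
  exact (h0 a ha).symm.trans (h0 b hb)

variable [CompleteSpace X]

/-- The semigroup `(x, f) ↦ (S(t) x, S_t x + T₀(t) f)` of the unperturbed delay equation. -/
noncomputable def delaySemigroup (p : ℝ≥0∞) [Fact (1 ≤ p)] (hS : IsC0Semigroup S) (t : ℝ) :
    (X × Lp₀ X p) →L[𝕜] (X × Lp₀ X p) :=
  ((S t).comp (ContinuousLinearMap.fst 𝕜 X (Lp₀ X p))).prod
    ((segmentOp p hS t).comp (ContinuousLinearMap.fst 𝕜 X (Lp₀ X p))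
      + (shiftOp 𝕜 X p t).comp (ContinuousLinearMap.snd 𝕜 X (Lp₀ X p)))

lemma delaySemigroup_apply (hS : IsC0Semigroup S) (t : ℝ) (z : X × Lp₀ X p) :
    delaySemigroup p hS t z = (S t z.1, segmentOp p hS t z.1 + shiftOp 𝕜 X p t z.2) := rfl

lemma coeFn_delaySemigroup_snd (hS : IsC0Semigroup S) {t : ℝ} (ht : 0 ≤ t) (z : X × Lp₀ X p) :
    (delaySemigroup p hS t z).2 =ᵐ[delayMeasure] fun τ => trajectory S z.1 z.2 (t + τ) := by
  rw [delaySemigroup_apply]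
  filter_upwards [Lp.coeFn_add (segmentOp p hS t z.1) (shiftOp 𝕜 X p t z.2),
    coeFn_segmentOp (p := p) hS ht z.1, coeFn_shiftOp (𝕜 := 𝕜) ht z.2] with τ h1 h2 h3
  rw [h1, Pi.add_apply, h2, h3, orbitSegment_add_leftShift]

lemma isC0Semigroup_delaySemigroup (hp : p ≠ ∞) (hS : IsC0Semigroup S)
    (hn : ImmediatelyNormContinuous S) : IsC0Semigroup (delaySemigroup p hS) where
  map_zero := by
    refine ContinuousLinearMap.ext fun z => ?_
    refine Prod.ext (hS.map_zero_apply z.1) (Lp.ext ?_)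
    filter_upwards [coeFn_delaySemigroup_snd hS le_rfl z, ae_mem_Icc] with τ h1 hτ
    rw [h1, zero_add, trajectory, if_pos hτ.2]
    rfl
  map_add s t hs ht := by
    refine ContinuousLinearMap.ext fun z => ?_
    refine Prod.ext (hS.map_add_apply hs ht z.1) (Lp.ext ?_)
    have h2 := leftShift_congr_ae hs (coeFn_delaySemigroup_snd hS ht z)
    change _ =ᵐ[delayMeasure] (delaySemigroup p hS s (delaySemigroup p hS t z)).2
    rw [delaySemigroup_apply hS s]
    filter_upwards [coeFn_delaySemigroup_snd hS (add_nonneg hs ht) z, h2,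
      Lp.coeFn_add (segmentOp p hS s (delaySemigroup p hS t z).1)
        (shiftOp 𝕜 X p s (delaySemigroup p hS t z).2),
      coeFn_segmentOp (p := p) hS hs (delaySemigroup p hS t z).1,
      coeFn_shiftOp (𝕜 := 𝕜) hs (delaySemigroup p hS t z).2] with τ h1 h2 h3 h4 h5
    rw [h1, h3, Pi.add_apply, h4, h5, h2, orbitSegment_add_leftShift]
    by_cases h : s + τ ≤ 0
    · rw [show s + t + τ = t + (s + τ) by ring]
      exact (if_pos h).symm
    · rw [show s + t + τ = s + τ + t by ring]
      push Not at h
      have e1 : trajectory S z.1 z.2 (s + τ + t) = S (s + τ + t) z.1 := if_neg (by linarith)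
      rw [e1, hS.map_add_apply h.le ht]
      exact (if_neg (not_le.2 h)).symm
  continuousOn_orbit z := by
    have h1 : ContinuousOn (fun t => segmentOp p hS t z.1) (Ici 0) :=
      (continuousOn_segmentOp hp hS hn).clm_apply continuousOn_const
    exact (hS.continuousOn_orbit z.1).prodMk (h1.add (continuousOn_shiftOp (𝕜 := 𝕜) hp z.2))

variable [NormedSpace ℝ X]

omit [CompleteSpace X] in
/-- The increment of a window integral, as the integral of increments. -/
lemma integral_window_sub {u : ℝ → X}
    (hu : ∀ {a b : ℝ}, -1 ≤ a → -1 ≤ b → IntervalIntegrable u volume a b) {t σ : ℝ} (ht : 0 ≤ t)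
    (hσ : -1 ≤ σ) :
    (∫ τ in (0 : ℝ)..σ, u (t + τ)) - ∫ τ in (0 : ℝ)..σ, u τ
      = (∫ s in σ..(σ + t), u s) - ∫ s in (0 : ℝ)..t, u s := by
  rw [intervalIntegral.integral_comp_add_left u, add_zero, add_comm t σ,
    intervalIntegral.integral_interval_sub_interval_comm (hu (by linarith) (by linarith))
      (hu (by linarith) hσ) (hu (by linarith) (by linarith)),
    intervalIntegral.integral_symm 0 t, intervalIntegral.integral_symm σ]
  abel

/-- Integration from `0` to `σ ∈ [-1, 0]` as a continuous linear map on `L^p([-1, 0], X)`. -/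
noncomputable def integralTo (X : Type*) [NormedAddCommGroup X] [NormedSpace ℝ X] (p : ℝ≥0∞)
    [Fact (1 ≤ p)] {σ : ℝ} (hσ : σ ∈ Icc (-1 : ℝ) 0) : Lp₀ X p →L[ℝ] X :=
  LinearMap.mkContinuous
    { toFun := fun f => ∫ τ in (0 : ℝ)..σ, f τ
      map_add' := fun f g => by
        rw [integral_congr_delay (Lp.coeFn_add f g) hσ]
        exact intervalIntegral.integral_add (intervalIntegrable_coe f hσ)
          (intervalIntegrable_coe g hσ)
      map_smul' := fun a f => by
        rw [integral_congr_delay (Lp.coeFn_smul a f) hσ]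
        exact intervalIntegral.integral_smul _ _ }
    1 fun f => by
      have hi : Integrable f delayMeasure := (Lp.memLp f).integrable (Fact.out : 1 ≤ p)
      change ‖∫ τ in (0 : ℝ)..σ, f τ‖ ≤ 1 * ‖f‖
      calc ‖∫ τ in (0 : ℝ)..σ, f τ‖ ≤ ∫ τ in uIoc 0 σ, ‖f τ‖ :=
            intervalIntegral.norm_integral_le_integral_norm_uIoc
        _ ≤ ∫ τ in Icc (-1 : ℝ) 0, ‖f τ‖ := by
            refine setIntegral_mono_set hi.norm (Eventually.of_forall fun _ => norm_nonneg _) ?_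
            rw [uIoc_of_ge hσ.2]
            refine LE.le.eventuallyLE ?_
            exact fun τ hτ => ⟨hσ.1.trans hτ.1.le, hτ.2⟩
        _ = (eLpNorm f 1 delayMeasure).toReal := by
            rw [eLpNorm_one_eq_lintegral_enorm,
              integral_norm_eq_lintegral_enorm hi.aestronglyMeasurable]
        _ ≤ (eLpNorm f p delayMeasure).toReal :=
            ENNReal.toReal_mono (Lp.eLpNorm_ne_top f)
              (eLpNorm_le_eLpNorm_of_exponent_le Fact.out (Lp.aestronglyMeasurable f))
        _ = 1 * ‖f‖ := by rw [one_mul, Lp.norm_def]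

omit [CompleteSpace X] in
lemma integralTo_apply {σ : ℝ} (hσ : σ ∈ Icc (-1 : ℝ) 0) (f : Lp₀ X p) :
    integralTo X p hσ f = ∫ τ in (0 : ℝ)..σ, f τ := rfl

/-- An element of `L^p([-1, 0], X)` is determined by its primitive. -/
lemma eq_of_integralTo_eq {f g : Lp₀ X p}
    (h : ∀ σ (hσ : σ ∈ Icc (-1 : ℝ) 0), integralTo X p hσ f = integralTo X p hσ g) : f = g := by
  have h1 : IsPrimitive (0 : Lp₀ X p) (f - g) 0 := by
    unfold IsPrimitive
    filter_upwards [Lp.coeFn_zero X p delayMeasure, ae_mem_Icc] with σ h2 hσ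
    rw [h2, Pi.zero_apply, zero_add, ← integralTo_apply hσ, map_sub, h σ hσ, sub_self]
  exact sub_eq_zero.1 (h1.unique IsPrimitive.zero).2

lemma integralTo_delaySemigroup (hS : IsC0Semigroup S) {t : ℝ} (ht : 0 ≤ t) (z : X × Lp₀ X p)
    {σ : ℝ} (hσ : σ ∈ Icc (-1 : ℝ) 0) :
    integralTo X p hσ (delaySemigroup p hS t z).2
      = ∫ τ in (0 : ℝ)..σ, trajectory S z.1 z.2 (t + τ) :=
  integral_congr_delay (coeFn_delaySemigroup_snd hS ht z) hσ

lemma integralTo_delaySemigroup_sub (hS : IsC0Semigroup S) {t : ℝ} (ht : 0 ≤ t)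
    (z : X × Lp₀ X p) {σ : ℝ} (hσ : σ ∈ Icc (-1 : ℝ) 0) :
    integralTo X p hσ ((delaySemigroup p hS t z).2 - z.2)
      = (∫ s in σ..(σ + t), trajectory S z.1 z.2 s)
        - ∫ s in (0 : ℝ)..t, trajectory S z.1 z.2 s := by
  rw [map_sub, integralTo_delaySemigroup hS ht z hσ,
    ← integral_window_sub (fun ha hb => intervalIntegrable_trajectory hS z.1 z.2 ha hb) ht hσ.1]
  congr 1
  refine intervalIntegral.integral_congr_ae (Eventually.of_forall fun s hs => ?_)
  rw [uIoc_of_ge hσ.2] at hs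
  rw [trajectory, if_pos hs.2]

variable [IsScalarTower ℝ 𝕜 X]

omit [Fact (1 ≤ p)] in
/-- The trajectory of `(x, f)` is a primitive of the trajectory of `(A x, f')`. -/
lemma trajectory_eq_primitive (hS : IsC0Semigroup S) {x y : X} {f g : Lp₀ X p}
    (hxy : (x, y) ∈ genGraph S) (hfg : IsPrimitive f g x) :
    ∀ᵐ r : ℝ, -1 ≤ r → trajectory S x f r = x + ∫ s in (0 : ℝ)..r, trajectory S y g s := by
  filter_upwards [(ae_restrict_iff' measurableSet_Icc).1 hfg] with r hr h1
  rcases le_or_gt r 0 with h | h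
  · rw [trajectory, if_pos h, hr ⟨h1, h⟩]
    congr 1
    refine intervalIntegral.integral_congr_ae (Eventually.of_forall fun s hs => ?_)
    rw [uIoc_of_ge h] at hs
    rw [trajectory, if_pos hs.2]
  · rw [trajectory, if_neg (not_le.2 h), hS.apply_eq_add_integral hxy h.le]
    congr 1
    refine intervalIntegral.integral_congr_ae (Eventually.of_forall fun s hs => ?_)
    rw [uIoc_of_le h.le] at hs
    rw [trajectory, if_neg (not_le.2 hs.1)]

/-- The generator of the unperturbed delay semigroup acts as `(x, f) ↦ (A x, f')` on the pairs
`(x, f)` with `x ∈ D(A)` and `f(0) = x`. -/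
theorem mem_genGraph_delaySemigroup (hp : p ≠ ∞) (hS : IsC0Semigroup S)
    (hn : ImmediatelyNormContinuous S) {v : (X × Lp₀ X p) × (X × Lp₀ X p)} :
    v ∈ genGraph (delaySemigroup p hS) ↔
      (v.1.1, v.2.1) ∈ genGraph S ∧ IsPrimitive v.1.2 v.2.2 v.1.1 := by
  have hT := isC0Semigroup_delaySemigroup hp hS hn
  obtain ⟨⟨x, f⟩, ⟨y, g⟩⟩ := v
  constructor
  · intro hv
    refine ⟨(continuous_fst.tendsto _).comp hv, ?_⟩
    have hsnd : Tendsto (fun h : ℝ => h⁻¹ • ((delaySemigroup p hS h (x, f)).2 - f)) (𝓝[>] 0)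
        (𝓝 g) := (continuous_snd.tendsto _).comp hv
    have hu : ∀ {a b : ℝ}, -1 ≤ a → -1 ≤ b →
        IntervalIntegrable (trajectory S x f) volume a b := fun ha hb =>
      intervalIntegrable_trajectory hS x f ha hb
    -- the integrated difference quotient is a difference of two averages of the trajectory: the one
    -- at `σ` tends to `f σ` almost everywhere by Lebesgue, the one at `0` tends to `x`
    unfold IsPrimitive
    filter_upwards [ae_restrict_of_ae
      (hu le_rfl (by norm_num : (-1 : ℝ) ≤ 1)).ae_hasDerivAt_integral, ae_mem_Icc]
      with σ hd hσ
    have hd' := hd (by rw [uIcc_of_le (by norm_num)]; exact ⟨hσ.1, by linarith [hσ.2]⟩) 0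
      (by rw [uIcc_of_le (by norm_num)]; exact ⟨by norm_num, by norm_num⟩)
    have l1 : Tendsto (fun h : ℝ => h⁻¹ • ∫ s in σ..(σ + h), trajectory S x f s) (𝓝[>] 0)
        (𝓝 (f σ)) := by
      have := hd'.tendsto_slope_zero_right
      rw [trajectory, if_pos hσ.2] at this
      refine this.congr' ?_
      filter_upwards [self_mem_nhdsWithin] with h hh
      have hh : 0 < h := hh
      rw [intervalIntegral.integral_interval_sub_left (hu (by norm_num) (by linarith [hσ.1]))
        (hu (by norm_num) hσ.1)]
    have l2 : Tendsto (fun h : ℝ => h⁻¹ • ∫ s in (0 : ℝ)..h, trajectory S x f s) (𝓝[>] 0)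
        (𝓝 x) := by
      have := tendsto_average_of_continuousWithinAt
        (fun h hh => hS.intervalIntegrable x le_rfl (le_of_lt hh))
        (hS.continuousOn_orbit x 0 self_mem_Ici)
      rw [hS.map_zero_apply] at this
      refine this.congr' ?_
      filter_upwards [self_mem_nhdsWithin] with h hh
      have hh : 0 < h := hh
      congr 1
      refine intervalIntegral.integral_congr_ae (Eventually.of_forall fun s hs => ?_)
      rw [uIoc_of_le hh.le] at hs
      rw [trajectory, if_neg (not_le.2 hs.1)]
    have l3 := ((integralTo X p hσ).continuous.tendsto g).comp hsnd
    have l4 := tendsto_nhds_unique (l3.congr' (by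
      filter_upwards [self_mem_nhdsWithin] with h hh
      rw [Function.comp, map_smul, integralTo_delaySemigroup_sub hS (le_of_lt hh) (x, f) hσ,
        smul_sub])) (l1.sub l2)
    rw [integralTo_apply] at l4
    simp only [l4]
    abel
  · rintro ⟨hxy, hfg⟩
    simp only at hxy hfg
    refine hT.mem_genGraph_of_integral fun t ht => ?_
    have hi := hT.intervalIntegrable (y, g) le_rfl ht.le
    refine Prod.ext ?_ ?_
    · have e1 := ((ContinuousLinearMap.fst 𝕜 X
        (Lp₀ X p)).restrictScalars ℝ).intervalIntegral_comp_comm hi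
      change S t x = x + (∫ s in (0 : ℝ)..t, delaySemigroup p hS s (y, g)).1
      rw [hS.apply_eq_add_integral hxy ht.le]
      exact congrArg _ e1
    · rw [Prod.snd_add, ← sub_eq_iff_eq_add']
      refine eq_of_integralTo_eq fun σ hσ => ?_
      -- both sides are the integral over `s ∈ [0, t]` of `trajectory (s + σ) - trajectory s`
      rw [integralTo_delaySemigroup_sub hS ht.le (x, f) hσ]
      have e1 := ((integralTo X p hσ).comp
        ((ContinuousLinearMap.snd 𝕜 X (Lp₀ X p)).restrictScalars ℝ)).intervalIntegral_comp_comm hi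
      refine Eq.trans ?_ e1
      have hu : ∀ {a b : ℝ}, -1 ≤ a → -1 ≤ b →
        IntervalIntegrable (trajectory S x f) volume a b := fun ha hb =>
        intervalIntegrable_trajectory hS x f ha hb
      have hw : ∀ {a b : ℝ}, -1 ≤ a → -1 ≤ b →
        IntervalIntegrable (trajectory S y g) volume a b := fun ha hb =>
        intervalIntegrable_trajectory hS y g ha hb
      have hprim := trajectory_eq_primitive hS hxy hfg
      have hprim' := (measurePreserving_add_right volume σ).quasiMeasurePreserving.ae hprim
      have e2 : ∫ s in σ..(σ + t), trajectory S x f s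
          = ∫ s in (0 : ℝ)..t, trajectory S x f (s + σ) := by
        rw [intervalIntegral.integral_comp_add_right (trajectory S x f), zero_add, add_comm t σ]
      have hu' : IntervalIntegrable (fun s => trajectory S x f (s + σ)) volume 0 t := by
        have := (hu hσ.1 (by linarith [hσ.1] : -1 ≤ σ + t)).comp_add_right σ
        simpa using this
      rw [e2, ← intervalIntegral.integral_sub hu' (hu (by norm_num) (by linarith))]
      refine intervalIntegral.integral_congr_ae ?_
      filter_upwards [hprim, hprim'] with s h1 h2 hs
      rw [uIoc_of_le ht.le] at hs
      rw [h1 (by linarith [hs.1]), h2 (by linarith [hs.1, hσ.1])]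
      change _ = integralTo X p hσ (delaySemigroup p hS s (y, g)).2
      rw [integralTo_delaySemigroup hS hs.1.le (y, g) hσ,
        intervalIntegral.integral_comp_add_left (trajectory S y g), add_zero,
        ← intervalIntegral.integral_interval_sub_left (a := 0) (b := s + σ) (c := s)
          (hw (by norm_num) (by linarith [hs.1, hσ.1])) (hw (by norm_num) (by linarith [hs.1]))]
      abel

end DelaySemigroup

end DelayEquation

/-! ### The delay operator as a perturbation -/

namespace DelayEquation

section NormContinuity

variable {𝕜 : Type*} [RCLike 𝕜] {X : Type*} [NormedAddCommGroup X] [NormedSpace 𝕜 X]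
  {p : ℝ≥0∞} [Fact (1 ≤ p)] {S : ℝ → X →L[𝕜] X} [CompleteSpace X]

/-- On `X × {0}` no history is transported, and the delay semigroup is immediately norm
continuous. -/
lemma continuousOn_delaySemigroup_comp_inl (hp : p ≠ ∞) (hS : IsC0Semigroup S)
    (hn : ImmediatelyNormContinuous S) :
    ContinuousOn (fun t => (delaySemigroup p hS t).comp (ContinuousLinearMap.inl 𝕜 X (Lp₀ X p)))
      (Ioi 0) := by
  have h1 : ContinuousOn S (Ioi 0) := hn
  have h2 := (continuousOn_segmentOp hp hS hn).mono Ioi_subset_Ici_self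
  refine (((continuousOn_const (c := ContinuousLinearMap.inl 𝕜 X (Lp₀ X p))).clm_comp h1).add
    ((continuousOn_const (c := ContinuousLinearMap.inr 𝕜 X (Lp₀ X p))).clm_comp h2)).congr
    fun t _ => ContinuousLinearMap.ext fun x => ?_
  simp [delaySemigroup_apply]

/-- After time `1` the whole history is forgotten, and the delay semigroup is norm continuous. -/
lemma continuousOn_delaySemigroup (hp : p ≠ ∞) (hS : IsC0Semigroup S)
    (hn : ImmediatelyNormContinuous S) : ContinuousOn (delaySemigroup p hS) (Ici 1) := by
  have h1 := ((continuousOn_delaySemigroup_comp_inl (p := p) hp hS hn).mono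
    (Ici_subset_Ioi.2 zero_lt_one)).clm_comp
    (continuousOn_const (c := ContinuousLinearMap.fst 𝕜 X (Lp₀ X p)))
  refine h1.congr fun t ht => ContinuousLinearMap.ext fun z => ?_
  simp [delaySemigroup_apply, shiftOp_eq_zero (𝕜 := 𝕜) (X := X) (p := p) ht]

variable [NormedSpace ℝ X] [IsScalarTower ℝ 𝕜 X]

/-- The delay operator `Φ` as an observation of the state: `((x, f), (A x, f')) ↦ Φ f`. -/
noncomputable def delayObservation (hp : p ≠ ∞) (hS : IsC0Semigroup S)
    (hn : ImmediatelyNormContinuous S) (Φ : W1p 𝕜 X p →L[𝕜] X) :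
    genGraph (delaySemigroup p hS) →L[𝕜] X :=
  Φ.comp ((((ContinuousLinearMap.snd 𝕜 X (Lp₀ X p)).prodMap
      (ContinuousLinearMap.snd 𝕜 X (Lp₀ X p))).comp
    (genGraph (delaySemigroup p hS)).subtypeL).codRestrict (W1p 𝕜 X p) fun v =>
      ⟨_, ((mem_genGraph_delaySemigroup hp hS hn).1 v.2).2⟩)

/-- The operator matrix with delay operator `Φ` is the perturbation of the generator of the delay
semigroup by `(x, f) ↦ (Φ f, 0)`. -/
lemma graph_delayOperator (hp : p ≠ ∞) (hS : IsC0Semigroup S) (hn : ImmediatelyNormContinuous S)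
    {A : X →ₗ.[𝕜] X} (hA : IsGenerator S A) (Φ : W1p 𝕜 X p →L[𝕜] X) :
    (delayOperator A Φ).graph = perturbedGraph (delayObservation hp hS hn Φ)
      (ContinuousLinearMap.inl 𝕜 X (Lp₀ X p)) := by
  have hgraph := isGenerator_iff.1 hA
  ext w
  rw [LinearPMap.mem_graph_iff, mem_perturbedGraph]
  constructor
  · rintro ⟨z, hz, hw⟩
    have hv : (z.1, (A ⟨z.1.1, z.2.1⟩, weakDeriv z)) ∈ genGraph (delaySemigroup p hS) :=
      (mem_genGraph_delaySemigroup hp hS hn).2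
        ⟨by rw [← hgraph]; exact A.mem_graph ⟨z.1.1, z.2.1⟩, weakDeriv_spec z⟩
    refine ⟨⟨_, hv⟩, Prod.ext hz ?_⟩
    rw [← hw]
    exact Prod.ext rfl (add_zero _)
  · rintro ⟨⟨⟨⟨x, f⟩, ⟨y, g⟩⟩, hv⟩, rfl⟩
    obtain ⟨hxy, hfg⟩ := (mem_genGraph_delaySemigroup hp hS hn).1 hv
    rw [← hgraph, LinearPMap.mem_graph_iff] at hxy
    obtain ⟨⟨x', hx'⟩, hxx, hAx⟩ := hxy
    simp only at hxx hAx hfg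
    subst hxx
    let z : delayDomain p A := ⟨(x', f), hx', g, hfg⟩
    have hz : weakDeriv z = g := ((weakDeriv_spec z).unique hfg).2
    refine ⟨z, rfl, ?_⟩
    refine Prod.ext ?_ (hz.trans (add_zero g).symm)
    have hΦ : (⟨(f, weakDeriv z), x', weakDeriv_spec z⟩ : W1p 𝕜 X p) = ⟨(f, g), x', hfg⟩ :=
      Subtype.ext (Prod.ext rfl hz)
    exact congrArg₂ (· + ·) hAx (congrArg Φ hΦ)

/-- Condition (K) bounds the integrated output of the observation `Φ`. -/
lemma integral_norm_output_le (hp : p ≠ ∞) (hS : IsC0Semigroup S)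
    (hn : ImmediatelyNormContinuous S) {A : X →ₗ.[𝕜] X} (hA : IsGenerator S A)
    {Φ : W1p 𝕜 X p →L[𝕜] X} {q : ℝ → ℝ≥0}
    (hb : ∀ z ∈ delayDomain p A, ∀ w : ℝ → W1p 𝕜 X p, (∀ s, 0 < s → IsSegment S z.1 z.2 s (w s)) →
      ∀ t, 0 < t → ∫⁻ s in Ioc 0 t, ‖Φ (w s)‖ₑ ≤ q t * ‖z‖ₑ)
    (v : genGraph (delaySemigroup p hS)) {t : ℝ} (ht : 0 < t) :
    ∫ s in (0 : ℝ)..t, ‖output (fun _ hv _ => (isC0Semigroup_delaySemigroup hp hS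
        hn).apply_mem_genGraph hv) (delayObservation hp hS hn Φ) v s‖
      ≤ q t * ‖(v : (X × Lp₀ X p) × (X × Lp₀ X p)).1‖ := by
  have hT := isC0Semigroup_delaySemigroup hp hS hn
  set c := output (fun _ hv _ => hT.apply_mem_genGraph hv) (delayObservation hp hS hn Φ) v with hc
  have hcc : Continuous c := continuous_output hT _ _ v
  obtain ⟨hxy, hfg⟩ := (mem_genGraph_delaySemigroup hp hS hn).1 v.2
  rw [← isGenerator_iff.1 hA] at hxy
  let o : ℝ → genGraph (delaySemigroup p hS) :=
    graphOrbit (fun _ hv _ => hT.apply_mem_genGraph hv) v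
  let w : ℝ → W1p 𝕜 X p := fun s => ⟨((o s).1.1.2, (o s).1.2.2),
    _, ((mem_genGraph_delaySemigroup hp hS hn).1 (o s).2).2⟩
  have hseg : ∀ s, 0 < s → IsSegment S v.1.1.1 v.1.1.2 s (w s) := by
    intro s hs
    have e : (w s).1.1 = (delaySemigroup p hS s v.1.1).2 := by
      change (o s).1.1.2 = _
      simp only [o, graphOrbit_of_nonneg _ _ hs.le]
    unfold IsSegment
    rw [e]
    filter_upwards [coeFn_delaySemigroup_snd hS hs.le v.1.1] with τ h1
    rw [h1, orbitSegment_add_leftShift]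
  have h1 := hb v.1.1 ⟨LinearPMap.mem_domain_of_mem_graph hxy, _, hfg⟩ w hseg t ht
  have h2 : ∀ s, Φ (w s) = c s := fun s => rfl
  simp only [h2] at h1
  rw [intervalIntegral.integral_of_le ht.le,
    integral_norm_eq_lintegral_enorm hcc.aestronglyMeasurable]
  refine (ENNReal.toReal_mono (ENNReal.mul_ne_top ENNReal.coe_ne_top enorm_ne_top) h1).trans_eq ?_
  rw [ENNReal.toReal_mul, ENNReal.coe_toReal, toReal_enorm]

end NormContinuity

end DelayEquation

theorem proposition5p3
    {𝕜 : Type*} [RCLike 𝕜]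
    {X : Type*} [NormedAddCommGroup X] [NormedSpace ℝ X] [NormedSpace 𝕜 X] [IsScalarTower ℝ 𝕜 X]
    [CompleteSpace X]
    (p : ℝ≥0∞) [Fact (1 ≤ p)] (hp : p ≠ ∞)
    (A : X →ₗ.[𝕜] X) (S : ℝ → X →L[𝕜] X)
    (hS : DelayEquation.IsC0Semigroup S) (hA : DelayEquation.IsGenerator S A)
    (Φ : DelayEquation.W1p 𝕜 X p →L[𝕜] X)
    (hK : DelayEquation.ConditionK S A Φ)
    (hnorm : DelayEquation.ImmediatelyNormContinuous S) :
    (∃ T : ℝ → (X × DelayEquation.Lp₀ X p) →L[𝕜] (X × DelayEquation.Lp₀ X p),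
      DelayEquation.IsC0Semigroup T ∧
        DelayEquation.IsGenerator T (DelayEquation.delayOperator A Φ)) ∧
    ∀ T : ℝ → (X × DelayEquation.Lp₀ X p) →L[𝕜] (X × DelayEquation.Lp₀ X p),
      DelayEquation.IsC0Semigroup T →
        DelayEquation.IsGenerator T (DelayEquation.delayOperator A Φ) →
          ContinuousOn T (Ici 1) := by
  obtain ⟨q, hq, hb⟩ := hK
  have hT₀ := DelayEquation.isC0Semigroup_delaySemigroup hp hS hnorm
  have hJ : ‖ContinuousLinearMap.inl 𝕜 X (DelayEquation.Lp₀ X p)‖ ≤ 1 :=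
    ContinuousLinearMap.opNorm_le_bound _ zero_le_one fun x => by simp [Prod.norm_def]
  obtain ⟨T, hT, hgen, hdiff⟩ := DelayEquation.exists_perturbed_semigroup hT₀
    (DelayEquation.delayObservation hp hS hnorm Φ) hJ hq
    fun v t ht => DelayEquation.integral_norm_output_le hp hS hnorm hA hb v ht
  have hgraph := DelayEquation.graph_delayOperator hp hS hnorm hA Φ
  refine ⟨⟨T, hT, DelayEquation.isGenerator_iff.2 (hgraph.trans hgen.symm)⟩,
    fun T' hT' hgen' => ?_⟩
  have hcont : ContinuousOn T (Ici 1) := by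
    have h1 := (hdiff (DelayEquation.continuousOn_delaySemigroup_comp_inl hp hS hnorm)).mono
      (Ici_subset_Ici.2 zero_le_one)
    refine (h1.add (DelayEquation.continuousOn_delaySemigroup hp hS hnorm)).congr fun t _ => ?_
    exact (sub_add_cancel _ _).symm
  refine hcont.congr fun t ht => hT'.eq_of_genGraph_le hT (le_of_eq ?_) (zero_le_one.trans ht)
  rw [hgen, ← hgraph, DelayEquation.isGenerator_iff.1 hgen']
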